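/- Let $\mathcal A$ be a unital algebra over $\mathbb C$, let $\mathcal B$ be a commutative unital algebra over $\mathbb C$, and let $\varphi:\mathcal A\to\mathcal B$ be linear with $\varphi(1)=1$. **Partitions.** An ordered set partition of $[n]=\{1,\dots,n\}$ is a sequence $\pi=(P_1,\dots,P_{|\pi|})$ of nonempty disjoint blocks with union $[n]$; $\mathcal{OP}_n$ is the set of all of them, and $\hat 1_n$ is the one with a single block. The kernel $\kappa(i_1,\dots,i_n)\in\mathcal{OP}_n$ of a multiindex has as its blocks the level sets of $k\mapsto i_k$, ordered by increasing value. For $\pi=(P_1,\dots,P_p)$ and $\sigma=(S_1,\dots,S_s)$ put $\pi\curlywedge\sigma=(P_1\cap S_1,\dots,P_1\cap S_s,P_2\cap S_1,\dots,P_p\cap S_s)$, where empty sets are skipped. Let $\mathcal{ONC}_n$ be the set of $\pi\in\mathcal{OP}_n$ that are noncrossing (there are no $i<j<k<l$ with $i,k$ in one block and $j,l$ in another one), let $\mathcal{OI}_n$ be the set of $\pi\in\mathcal{OP}_n$ all of whose blocks are intervals, and let $\mathcal{MP}_n$ be the set of monotone partitions, i.e. of those $\pi\in\mathcal{ONC}_n$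 such that $P_a$ precedes $P_b$ (that is, $a<b$) whenever there are $i,j\in P_a$ with $i<k<j$ for all $k\in P_b$. **Spreadability systems and cumulants.** A spreadability system for $(\mathcal A,\varphi)$ is a triple $\mathcal S=(\mathcal U,\widetilde\varphi,(\iota^{(j)})_{j\ge1})$ of a unital algebra $\mathcal U$, a unital linear map $\widetilde\varphi:\mathcal U\to\mathcal B$ and (not necessarily unital) homomorphisms $\iota^{(j)}:\mathcal A\to\mathcal U$, $X\mapsto X^{(j)}$, such that $\widetilde\varphi\circ\iota^{(j)}=\varphi$ and $\widetilde\varphi(X_1^{(i_1)}\cdots X_n^{(i_n)})=\widetilde\varphi(X_1^{(h(i_1))}\cdots X_n^{(h(i_n))})$ for every strictly increasing $h:\{i_1,\dots,i_n\}\to\mathbb N$. Put $\varphi_\pi(X_1,\dots,X_n)=\widetilde\varphi(X_1^{(i_1)}\cdots X_n^{(i_n)})$ for any $(i_1,\dots,i_n)$ with kernel $\pi$. For $N\in\mathbb N$ put $$\varphi_\pi(N.X_1,\dots,N.X_n)=\sum_{i_1,\dots,i_n=1}^N\varphi_{\pi\curlywedge\kappa(i_1,\dots,i_n)}(X_1,\dots,X_n),$$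 which is a polynomial in $N$. The cumulant $K_\pi(X_1,\dots,X_n)$ is the coefficient of $N^{|\pi|}$ in this polynomial. Write $K_m=K_{\hat 1_m}$ and $$K_{(\pi)}(X_1,\dots,X_n)=\prod_{P\in\pi}K_{|P|}(X_P),\qquad X_P=(X_{p_1},\dots,X_{p_k})\ \text{ for } P=\{p_1<\dots<p_k\}.$$ **The four systems.** $\mathcal S_{\mathrm T}$: $\mathcal U$ is the algebraic infinite tensor product of copies of $\mathcal A$, with $\widetilde\varphi=\bigotimes\varphi$. $\mathcal S_{\mathrm F}$: $\mathcal U$ is the free product of copies of $\mathcal A$ with identification of units, and $\widetilde\varphi$ is the free product of copies of $\varphi$, i.e. it is unital and its $\mathcal B$-linear extension to $\mathcal B\otimes\mathcal U$ vanishes on the products $\prod_{k=1}^n(X_k^{(i_k)}-\varphi(X_k))$ with $n\ge1$ and $i_k\ne i_{k+1}$ for all $k<n$. $\mathcal S_{\mathrm B}$ and $\mathcal S_{\mathrm M}$: $\mathcal U$ is the unitization of the free product of copies of $\mathcal A$ without identification of units; in the Boolean case $\widetilde\varphi(1)=1$ and $\widetilde\varphi(X_1^{(i_1)}\cdots X_n^{(i_n)})=\varphi(X_1)\cdots\varphi(X_n)$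 if $i_k\neq i_{k+1}$ for all $k<n$; in the monotone case $\widetilde\varphi(1)=1$, $\widetilde\varphi(X^{(i)})=\varphi(X)$, and for $n\ge2$ a factor $X_k^{(i_k)}$ of $X_1^{(i_1)}\cdots X_n^{(i_n)}$ whose index $i_k$ is strictly larger than the indices of its (one or two) neighbours may be removed at the price of the scalar factor $\varphi(X_k)$. In each case $\iota^{(j)}$ is the embedding of $\mathcal A$ as the $j$-th copy. **Proposition.** Let $K^{\mathrm T},K^{\mathrm F},K^{\mathrm B},K^{\mathrm M}$ be the cumulants of $\mathcal S_{\mathrm T},\mathcal S_{\mathrm F},\mathcal S_{\mathrm B},\mathcal S_{\mathrm M}$. For all $n$ and all $\pi\in\mathcal{OP}_n$, as functionals on $\mathcal A^n$: 1. $K^{\mathrm T}_\pi=K^{\mathrm T}_{(\pi)}$. 2. $K^{\mathrm F}_\pi=K^{\mathrm F}_{(\pi)}$ if $\pi\in\mathcal{ONC}_n$, and $K^{\mathrm F}_\pi=0$ if $\pi\notin\mathcal{ONC}_n$. 3. $K^{\mathrm B}_\pi=K^{\mathrm B}_{(\pi)}$ if $\pi\in\mathcal{OI}_n$, and $K^{\mathrm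 B}_\pi=0$ if $\pi\notin\mathcal{OI}_n$. 4. $K^{\mathrm M}_\pi=K^{\mathrm M}_{(\pi)}$ if $\pi\in\mathcal{MP}_n$, and $K^{\mathrm M}_\pi=0$ if $\pi\notin\mathcal{MP}_n$. -/

import Mathlib

open scoped TensorProduct

universe u v

/-- An ordered set partition `(P₀, P₁, …)` of `Fin n`, encoded by the map sending each point to
the number of its block. Surjectivity says that no block is empty. -/
@[ext]
structure OrderedSetPartition (n : ℕ) where
  /-- the number of blocks -/
  size : ℕ
  /-- the number of the block containing a point -/
  idx : Fin n → Fin size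
  surj : Function.Surjective idx

namespace OrderedSetPartition

variable {n : ℕ}

/-- The `a`-th block. -/
def block (π : OrderedSetPartition n) (a : Fin π.size) : Finset (Fin n) :=
  Finset.univ.filter fun k => π.idx k = a

/-- The ordered kernel set partition of a multiindex: `k` and `l` are in the same block iff
`i k = i l`, and the blocks are ordered by increasing value of `i`. -/
noncomputable def kernel {α : Type*} [LinearOrder α] (i : Fin n → α) : OrderedSetPartition n where
  size := (Finset.univ.image i).card
  idx k := ((Finset.univ.image i).orderIsoOfFin rfl).symm
    ⟨i k, Finset.mem_image_of_mem i (Finset.mem_univ k)⟩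
  surj := by
    intro a
    obtain ⟨k, -, hk⟩ := Finset.mem_image.1 ((Finset.univ.image i).orderIsoOfFin rfl a).2
    refine ⟨k, ?_⟩
    rw [OrderIso.symm_apply_eq]
    exact Subtype.ext hk

/-- The quasi-meet `(P₁ ∩ S₁, P₁ ∩ S₂, …, P₂ ∩ S₁, P₂ ∩ S₂, …)` with empty intersections skipped,
for `π = (P₁, P₂, …)` and `σ = (S₁, S₂, …)`: the blocks are the nonempty intersections, in the
lexicographic order of the pairs of block numbers. -/
noncomputable def quasiMeet (π σ : OrderedSetPartition n) : OrderedSetPartition n :=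
  kernel fun k => toLex (π.idx k, σ.idx k)

/-- The maximal ordered set partition, with `Fin n` as its only block (no block if `n = 0`). -/
noncomputable def maximal (n : ℕ) : OrderedSetPartition n :=
  kernel fun _ => (0 : ℕ)

/-- No `i < j < k < l` with `i ∼ k`, `j ∼ l` and `i ≁ j`. -/
def IsNoncrossing (π : OrderedSetPartition n) : Prop :=
  ∀ i j k l : Fin n, i < j → j < k → k < l →
    π.idx i = π.idx k → π.idx j = π.idx l → π.idx i = π.idx j

/-- Every block is an interval. -/
def IsInterval (π : OrderedSetPartition n) : Prop :=
  ∀ a : Fin π.size, (π.block a : Set (Fin n)).OrdConnected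

/-- The blocks `a` (outer) and `b` (inner) form a nesting. -/
def IsNesting (π : OrderedSetPartition n) (a b : Fin π.size) : Prop :=
  ∃ i ∈ π.block a, ∃ j ∈ π.block a, ∀ k ∈ π.block b, i < k ∧ k < j

/-- A monotone partition: noncrossing, and in every nesting the outer block precedes the inner
block. -/
def IsMonotone (π : OrderedSetPartition n) : Prop :=
  π.IsNoncrossing ∧ ∀ a b : Fin π.size, π.IsNesting a b → a < b

/-- The kernel only depends on the order relations between the entries of the multiindex. -/
theorem exists_strictMonoOn_kernel (i : Fin n → ℕ) :
    ∃ h : ℕ → ℕ, StrictMonoOn h (Set.range i) ∧ ∀ k, h (i k) = ((kernel i).idx k : ℕ) := by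
  classical
  refine ⟨fun m => if hm : m ∈ Finset.univ.image i then
    (((Finset.univ.image i).orderIsoOfFin rfl).symm ⟨m, hm⟩ : ℕ) else 0, ?_, ?_⟩
  · rintro _ ⟨k, rfl⟩ _ ⟨l, rfl⟩ hkl
    simp only [Finset.mem_image_of_mem i (Finset.mem_univ _), dif_pos]
    exact ((Finset.univ.image i).orderIsoOfFin rfl).symm.strictMono hkl
  · intro k
    simp only [Finset.mem_image_of_mem i (Finset.mem_univ _), dif_pos]
    rfl

/-- A sum over multiindices with entries in `Fin N` that only depends on the ordered kernel is a
polynomial in `N`. -/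
theorem exists_polynomial_sum_kernel {B : Type v} [CommRing B] [Algebra ℂ B]
    (g : OrderedSetPartition n → B) :
    ∃ p : Polynomial B, ∀ N : ℕ,
      p.eval (N : B) = ∑ i : Fin n → Fin N, g (kernel i) := by
  classical
  let G : ℕ → B := fun k => ∑ f : Fin n → Fin k,
    if hf : Function.Surjective f then g ⟨k, f, hf⟩ else 0
  have hG : ∀ k, n < k → G k = 0 := by
    intro k hk
    refine Finset.sum_eq_zero fun f _ => dif_neg fun hf => ?_
    have := Fintype.card_le_of_surjective f hf
    simp at this
    omega
  have key : ∀ N : ℕ, ∑ i : Fin n → Fin N, g (kernel i)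
      = ∑ k ∈ Finset.range (n + 1), (N.choose k : B) * G k := by
    intro N
    have h1 : ∑ i : Fin n → Fin N, g (kernel i)
        = ∑ R ∈ (Finset.univ : Finset (Fin N)).powerset, G R.card := by
      rw [← Finset.sum_fiberwise_of_maps_to
        (s := Finset.univ) (t := (Finset.univ : Finset (Fin N)).powerset)
        (g := fun i : Fin n → Fin N => Finset.univ.image i) (by simp)]
      refine Finset.sum_congr rfl fun R _ => ?_
      simp only [G]
      rw [← Finset.sum_filter_of_ne (p := fun f : Fin n → Fin R.card => Function.Surjective f)
        (by intro f _ hf; by_contra h; exact hf (dif_neg h))]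
      symm
      refine Finset.sum_bij (fun f _ k => R.orderEmbOfFin rfl (f k)) ?_ ?_ ?_ ?_
      · intro f hf
        simp only [Finset.mem_filter, Finset.mem_univ, true_and] at hf ⊢
        conv_rhs => rw [← Finset.image_orderEmbOfFin_univ R rfl]
        ext x
        simp only [Finset.mem_image, Finset.mem_univ, true_and]
        constructor
        · rintro ⟨k, rfl⟩; exact ⟨f k, rfl⟩
        · rintro ⟨a, rfl⟩; obtain ⟨k, rfl⟩ := hf a; exact ⟨k, rfl⟩
      · intro f _ f' _ h
        funext k
        exact (R.orderEmbOfFin rfl).injective (congrFun h k)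
      · intro i hi
        simp only [Finset.mem_filter, Finset.mem_univ, true_and] at hi
        subst hi
        refine ⟨(kernel i).idx,
          Finset.mem_filter.2 ⟨Finset.mem_univ _, (kernel i).surj⟩, funext fun k => ?_⟩
        change (Finset.univ.image i).orderEmbOfFin rfl
          (((Finset.univ.image i).orderIsoOfFin rfl).symm _) = i k
        rw [← Finset.coe_orderIsoOfFin_apply, OrderIso.apply_symm_apply]
      · intro f hf
        simp only [Finset.mem_filter, Finset.mem_univ, true_and] at hf
        rw [dif_pos hf]
        congr 1
        have himg : Finset.univ.image (fun k => R.orderEmbOfFin rfl (f k)) = R := by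
          conv_rhs => rw [← Finset.image_orderEmbOfFin_univ R rfl]
          ext x
          simp only [Finset.mem_image, Finset.mem_univ, true_and]
          constructor
          · rintro ⟨k, rfl⟩; exact ⟨f k, rfl⟩
          · rintro ⟨a, rfl⟩; obtain ⟨k, rfl⟩ := hf a; exact ⟨k, rfl⟩
        have gen : ∀ (T : Finset (Fin N)) (hT : T = R)
            (hm : ∀ k, R.orderEmbOfFin rfl (f k) ∈ T)
            (hs : Function.Surjective fun k =>
              (T.orderIsoOfFin rfl).symm ⟨R.orderEmbOfFin rfl (f k), hm k⟩),
            (⟨R.card, f, hf⟩ : OrderedSetPartition n) = ⟨T.card, _, hs⟩ := by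
          intro T hT hm hs
          subst hT
          congr 1
          funext k
          rw [eq_comm, OrderIso.symm_apply_eq]
          exact Subtype.ext (by simp)
        exact gen _ himg (fun k => Finset.mem_image_of_mem _ (Finset.mem_univ k)) (kernel _).surj
    rw [h1, Finset.sum_powerset_apply_card]
    simp only [Finset.card_univ, Fintype.card_fin, nsmul_eq_mul]
    rcases le_total N n with h | h
    · refine Finset.sum_subset (Finset.range_mono (by omega)) fun k _ hk => ?_
      rw [Nat.choose_eq_zero_of_lt (by simpa using hk)]
      simp
    · symm
      refine Finset.sum_subset (Finset.range_mono (by omega)) fun k _ hk => ?_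
      rw [hG k (by simpa using hk), mul_zero]
  refine ⟨∑ k ∈ Finset.range (n + 1),
    Polynomial.C (algebraMap ℂ B ((k.factorial : ℂ)⁻¹) * G k) * descPochhammer B k, fun N => ?_⟩
  rw [key, Polynomial.eval_finsetSum]
  refine Finset.sum_congr rfl fun k _ => ?_
  rw [Polynomial.eval_mul, Polynomial.eval_C, descPochhammer_eval_eq_descFactorial,
    Nat.descFactorial_eq_factorial_mul_choose]
  push_cast
  have : algebraMap ℂ B ((k.factorial : ℂ)⁻¹) * (k.factorial : B) = 1 := by
    rw [← map_natCast (algebraMap ℂ B), ← map_mul, inv_mul_cancel₀, map_one]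
    exact_mod_cast k.factorial_ne_zero
  linear_combination (N.choose k : B) * G k * this

end OrderedSetPartition

/-- A spreadability system for the `B`-valued noncommutative probability space `(A, φ)`. The copies
of `A` are indexed by `ℕ`; the embeddings need not preserve the unit. -/
structure SpreadabilitySystem {A : Type u} {B : Type v} [Ring A] [Algebra ℂ A] [CommRing B]
    [Algebra ℂ B] (φ : A →ₗ[ℂ] B) where
  U : Type u
  [ring : Ring U]
  [algebra : Algebra ℂ U]
  /-- the expectation on `U` -/
  expect : U →ₗ[ℂ] B
  expect_one : expect 1 = 1
  /-- the embeddings `X ↦ X⁽ʲ⁾` -/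
  emb : ℕ → A →ₙₐ[ℂ] U
  expect_emb : ∀ j X, expect (emb j X) = φ X
  spread : ∀ (n : ℕ) (X : Fin n → A) (i : Fin n → ℕ) (h : ℕ → ℕ), StrictMonoOn h (Set.range i) →
    expect (List.ofFn fun k => emb (i k) (X k)).prod
      = expect (List.ofFn fun k => emb (h (i k)) (X k)).prod

namespace SpreadabilitySystem

attribute [instance] SpreadabilitySystem.ring SpreadabilitySystem.algebra

variable {A : Type u} {B : Type v} [Ring A] [Algebra ℂ A] [CommRing B] [Algebra ℂ B]
  {φ : A →ₗ[ℂ] B} (S : SpreadabilitySystem φ) {n : ℕ}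

/-- The partitioned moment `φ_π(X₁, …, Xₙ)`, computed with the representative `i k = π.idx k` of
`π`. -/
noncomputable def moment (π : OrderedSetPartition n) (X : Fin n → A) : B :=
  S.expect (List.ofFn fun k => S.emb (π.idx k : ℕ) (X k)).prod

/-- Any multiindex `i` with kernel `π` may be used to compute `φ_π`. -/
theorem moment_kernel (i : Fin n → ℕ) (X : Fin n → A) :
    S.moment (OrderedSetPartition.kernel i) X
      = S.expect (List.ofFn fun k => S.emb (i k) (X k)).prod := by
  obtain ⟨h, hh, hi⟩ := OrderedSetPartition.exists_strictMonoOn_kernel i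
  rw [S.spread n X i h hh, moment]
  simp only [hi]

/-- `φ_π(N.X₁, …, N.Xₙ)`, that is, the sum of `φ_{π ⋏ κ(i₁, …, iₙ)}(X₁, …, Xₙ)` over all
`(i₁, …, iₙ) ∈ [N]ⁿ`. -/
noncomputable def dotMoment (π : OrderedSetPartition n) (X : Fin n → A) (N : ℕ) : B :=
  ∑ i : Fin n → Fin N, S.moment (π.quasiMeet (OrderedSetPartition.kernel i)) X

theorem exists_dotPolynomial (π : OrderedSetPartition n) (X : Fin n → A) :
    ∃ p : Polynomial B, ∀ N : ℕ, p.eval (N : B) = S.dotMoment π X N :=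
  OrderedSetPartition.exists_polynomial_sum_kernel fun τ => S.moment (π.quasiMeet τ) X

/-- The polynomial `p` with `p(N) = φ_π(N.X₁, …, N.Xₙ)` for all `N`. -/
noncomputable def dotPolynomial (π : OrderedSetPartition n) (X : Fin n → A) : Polynomial B :=
  (S.exists_dotPolynomial π X).choose

/-- The partitioned cumulant `K_π(X₁, …, Xₙ)`: the coefficient of `N ^ |π|` in
`φ_π(N.X₁, …, N.Xₙ)`. -/
noncomputable def cumulant (π : OrderedSetPartition n) (X : Fin n → A) : B :=
  (S.dotPolynomial π X).coeff π.size

/-- The multiplicative extension `K_(π)(X₁, …, Xₙ) = ∏_{P ∈ π} K_{|P|}(X_P)`, where `X_P` lists the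
entries of `X` at the points of `P` in increasing order and `K_m` is the cumulant of the maximal
ordered set partition of `Fin m`. -/
noncomputable def mulCumulant (π : OrderedSetPartition n) (X : Fin n → A) : B :=
  ∏ a : Fin π.size, S.cumulant (OrderedSetPartition.maximal (π.block a).card)
    fun k => X ((π.block a).orderEmbOfFin rfl k)

end SpreadabilitySystem

namespace Words

variable {A : Type u} {B : Type v} [Ring A] [Algebra ℂ A] [CommRing B] [Algebra ℂ B]

/-- A letter `(i, a)` stands for the element `a` of the `i`-th copy of `A`. This is the space of
all functions of words that are linear in every letter and that do not change when two
neighbouring letters from the same copy are multiplied. -/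
def multiplicative (A : Type u) (B : Type v) [Ring A] [Algebra ℂ A] [CommRing B] [Algebra ℂ B] :
    Submodule ℂ (List (ℕ × A) → B) where
  carrier := {f |
    (∀ u w i a b, f (u ++ (i, a + b) :: w) = f (u ++ (i, a) :: w) + f (u ++ (i, b) :: w)) ∧
    (∀ u w i (c : ℂ) a, f (u ++ (i, c • a) :: w) = c • f (u ++ (i, a) :: w)) ∧
    ∀ u w i a b, f (u ++ (i, a * b) :: w) = f (u ++ (i, a) :: (i, b) :: w)}
  add_mem' {f g} hf hg := by
    refine ⟨fun u w i a b => ?_, fun u w i c a => ?_, fun u w i a b => ?_⟩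
    · simp only [Pi.add_apply, hf.1, hg.1]; ring
    · simp only [Pi.add_apply, hf.2.1, hg.2.1, smul_add]
    · simp only [Pi.add_apply, hf.2.2, hg.2.2]
  zero_mem' := by simp
  smul_mem' c f hf := by
    refine ⟨fun u w i a b => ?_, fun u w i d a => ?_, fun u w i a b => ?_⟩
    · simp only [Pi.smul_apply, hf.1, smul_add]
    · simp only [Pi.smul_apply, hf.2.1]; rw [smul_comm]
    · simp only [Pi.smul_apply, hf.2.2]

/-- The functions in `multiplicative A B` that do not change when a letter `1` is removed. -/
def unital (A : Type u) (B : Type v) [Ring A] [Algebra ℂ A] [CommRing B] [Algebra ℂ B] :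
    Submodule ℂ (List (ℕ × A) → B) where
  carrier := {f | f ∈ multiplicative A B ∧ ∀ u w i, f (u ++ (i, 1) :: w) = f (u ++ w)}
  add_mem' {f g} hf hg := ⟨add_mem hf.1 hg.1, fun u w i => by
    simp only [Pi.add_apply, hf.2, hg.2]⟩
  zero_mem' := ⟨zero_mem _, by simp⟩
  smul_mem' c f hf := ⟨Submodule.smul_mem _ c hf.1, fun u w i => by
    simp only [Pi.smul_apply, hf.2]⟩

/-- The letter `(i, a)` acts on functions of words by appending it to the argument. -/
def act (i : ℕ) : A →ₙₐ[ℂ] Module.End ℂ (multiplicative A B) where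
  toFun a :=
    { toFun := fun f => ⟨fun w => f.1 (w ++ [(i, a)]), by
        refine ⟨fun u w j b c => ?_, fun u w j c b => ?_, fun u w j b c => ?_⟩
        · simpa using f.2.1 u (w ++ [(i, a)]) j b c
        · simpa using f.2.2.1 u (w ++ [(i, a)]) j c b
        · simpa using f.2.2.2 u (w ++ [(i, a)]) j b c⟩
      map_add' := fun _ _ => rfl
      map_smul' := fun _ _ => rfl }
  map_zero' := by
    refine LinearMap.ext fun f => Subtype.ext (funext fun w => ?_)
    simpa using f.2.2.1 w [] i 0 0
  map_add' a b := LinearMap.ext fun f => Subtype.ext (funext fun w => f.2.1 w [] i a b)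
  map_mul' a b := LinearMap.ext fun f => Subtype.ext (funext fun w => by
    simpa using f.2.2.2 w [] i a b)
  map_smul' c a := LinearMap.ext fun f => Subtype.ext (funext fun w => f.2.2.1 w [] i c a)

/-- The same action on `unital A B`. -/
def unitalAct (i : ℕ) : A →ₐ[ℂ] Module.End ℂ (unital A B) :=
  AlgHom.ofLinearMap
    { toFun := fun a =>
        { toFun := fun f => ⟨fun w => f.1 (w ++ [(i, a)]), by
            refine ⟨(act (A := A) (B := B) i a ⟨f.1, f.2.1⟩).2, fun u w j => ?_⟩
            simpa using f.2.2 u (w ++ [(i, a)]) j⟩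
          map_add' := fun _ _ => rfl
          map_smul' := fun _ _ => rfl }
      map_add' := fun a b =>
        LinearMap.ext fun f => Subtype.ext (funext fun w => f.2.1.1 w [] i a b)
      map_smul' := fun c a =>
        LinearMap.ext fun f => Subtype.ext (funext fun w => f.2.1.2.1 w [] i c a) }
    (LinearMap.ext fun f => Subtype.ext (funext fun w => by simpa using f.2.2 w [] i))
    (fun a b => LinearMap.ext fun f => Subtype.ext (funext fun w => by
      simpa using f.2.1.2.2 w [] i a b))

/-- The free product of countably many copies of `A` with identification of units. -/
abbrev FreeProd (A : Type u) [Ring A] [Algebra ℂ A] : Type u :=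
  LinearAlgebra.FreeProduct ℂ fun _ : ℕ => A

/-- The unitization `ℂ 1 ⊕ U₀` of the free product `U₀` of countably many copies of `A` without
identification of units. Adjoining a unit carries coproducts of non-unital algebras to coproducts
of unital algebras, so this is the free product, with identification of units, of the
unitizations `ℂ 1 ⊕ A`. -/
abbrev FreeProd₀ (A : Type u) [Ring A] [Algebra ℂ A] : Type u :=
  LinearAlgebra.FreeProduct ℂ fun _ : ℕ => Unitization ℂ A

/-- The embedding of `A` as the `i`-th copy. -/
noncomputable def emb (i : ℕ) : A →ₐ[ℂ] FreeProd A :=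
  LinearAlgebra.FreeProduct.ι ℂ (fun _ : ℕ => A) i

/-- The (non-unital) embedding of `A` as the `i`-th copy. -/
noncomputable def emb₀ (i : ℕ) : A →ₙₐ[ℂ] FreeProd₀ A :=
  ((LinearAlgebra.FreeProduct.ι ℂ (fun _ : ℕ => Unitization ℂ A) i :
    Unitization ℂ A →ₐ[ℂ] FreeProd₀ A) : Unitization ℂ A →ₙₐ[ℂ] FreeProd₀ A).comp
    (Unitization.inrNonUnitalAlgHom ℂ A)

/-- The linear functional on the free product with the given values on words. -/
noncomputable def lift (f : unital A B) : FreeProd A →ₗ[ℂ] B where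
  toFun x := (LinearAlgebra.FreeProduct.lift ℂ (fun _ : ℕ => A)
    (fun {i} => unitalAct (A := A) (B := B) i) x f).1 []
  map_add' x y := by simp
  map_smul' c x := by simp

/-- The linear functional on the free product with the given values on words. -/
noncomputable def lift₀ (f : multiplicative A B) : FreeProd₀ A →ₗ[ℂ] B where
  toFun x := (LinearAlgebra.FreeProduct.lift ℂ (fun _ : ℕ => Unitization ℂ A)
    (fun {i} => Unitization.lift (act (A := A) (B := B) i)) x f).1 []
  map_add' x y := by simp
  map_smul' c x := by simp

theorem lift_word (f : unital A B) (w : List (ℕ × A)) :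
    lift f (w.map fun x => emb x.1 x.2).prod = f.1 w := by
  have key : ∀ (w u : List (ℕ × A)),
      (LinearAlgebra.FreeProduct.lift ℂ (fun _ : ℕ => A)
        (fun {i} => unitalAct (A := A) (B := B) i) (w.map fun x => emb x.1 x.2).prod f).1 u
      = f.1 (u ++ w) := by
    intro w
    induction w with
    | nil => intro u; simp
    | cons x w ih =>
      intro u
      have h : LinearAlgebra.FreeProduct.lift ℂ (fun _ : ℕ => A)
          (fun {i} => unitalAct (A := A) (B := B) i) (emb x.1 x.2) = unitalAct x.1 x.2 :=
        DFunLike.congr_fun (LinearAlgebra.FreeProduct.lift_comp_ι (i := x.1) ℂ (fun _ : ℕ => A)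
          (fun {i} => unitalAct (A := A) (B := B) i)) x.2
      rw [List.map_cons, List.prod_cons, map_mul, h]
      refine (ih (u ++ [(x.1, x.2)])).trans ?_
      simp
  exact key w []

theorem lift₀_word (f : multiplicative A B) (w : List (ℕ × A)) :
    lift₀ f (w.map fun x => emb₀ x.1 x.2).prod = f.1 w := by
  have key : ∀ (w u : List (ℕ × A)),
      (LinearAlgebra.FreeProduct.lift ℂ (fun _ : ℕ => Unitization ℂ A)
        (fun {i} => Unitization.lift (act (A := A) (B := B) i))
        (w.map fun x => emb₀ x.1 x.2).prod f).1 u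
      = f.1 (u ++ w) := by
    intro w
    induction w with
    | nil => intro u; simp
    | cons x w ih =>
      intro u
      have h : LinearAlgebra.FreeProduct.lift ℂ (fun _ : ℕ => Unitization ℂ A)
          (fun {i} => Unitization.lift (act (A := A) (B := B) i)) (emb₀ x.1 x.2)
          = act (A := A) (B := B) x.1 x.2 := by
        refine (DFunLike.congr_fun (LinearAlgebra.FreeProduct.lift_comp_ι (i := x.1) ℂ
          (fun _ : ℕ => Unitization ℂ A)
          (fun {i} => Unitization.lift (act (A := A) (B := B) i))) (x.2 : Unitization ℂ A)).trans ?_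
        simp
      rw [List.map_cons, List.prod_cons, map_mul, h]
      refine (ih (u ++ [(x.1, x.2)])).trans ?_
      simp
  exact key w []

end Words

namespace Words

section Alternating

variable {A : Type u}

/-- Neighbouring letters belong to different copies. -/
def Alternating (s : List (ℕ × A)) : Prop :=
  s.IsChain fun x y => x.1 ≠ y.1

theorem Alternating.tail {x : ℕ × A} {s : List (ℕ × A)} (h : Alternating (x :: s)) :
    Alternating s := List.IsChain.tail h

theorem Alternating.change {i : ℕ} {a : A} {s : List (ℕ × A)} (h : Alternating ((i, a) :: s))
    (b : A) : Alternating ((i, b) :: s) := by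
  cases s with
  | nil => simp [Alternating]
  | cons y s => simpa [Alternating] using h

end Alternating

variable {A : Type u} {B : Type v} [Ring A] [Algebra ℂ A] [CommRing B] [Algebra ℂ B]

/-- The value of the Boolean product on the word `(i, a) :: w`: neighbouring letters from the same
copy are multiplied, then `φ` is applied to the maximal runs. -/
def booleanAux (φ : A →ₗ[ℂ] B) (i : ℕ) (a : A) : List (ℕ × A) → B
  | [] => φ a
  | (j, b) :: w => if i = j then booleanAux φ i (a * b) w else φ a * booleanAux φ j b w

/-- The value of the Boolean product on a word. -/
def boolean (φ : A →ₗ[ℂ] B) : List (ℕ × A) → B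
  | [] => 1
  | (i, a) :: w => booleanAux φ i a w

/-- The value of the monotone product on the word `s.reverse ++ w`, where the indices decrease
along `s`. The letters of `w` are moved to the top of `s` one after the other; whenever the top
letter of `s` is a peak, it is removed and contributes a factor. -/
def monotoneAux (φ : A →ₗ[ℂ] B) : List (ℕ × A) → List (ℕ × A) → B
  | s, [] => (s.map fun x => φ x.2).prod
  | [], (j, b) :: w => monotoneAux φ [(j, b)] w
  | (i, a) :: s, (j, b) :: w =>
    if i < j then monotoneAux φ ((j, b) :: (i, a) :: s) w
    else if i = j then monotoneAux φ ((i, a * b) :: s) w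
    else φ a * monotoneAux φ s ((j, b) :: w)
  termination_by s w => 2 * w.length + s.length
  decreasing_by all_goals (simp only [List.length_cons, List.length_nil]; omega)

/-- The value of the free product on the word `x₁° ⋯ xₖ° w`, where `s = [xₖ, …, x₁]` is alternating
and `x° = x - φ(x)`. The first letter `b` of `w` is written as `φ(b) + b°` if it does not belong to
the copy of `xₖ`. Otherwise `xₖ° b = φ(xₖ b) - φ(xₖ) φ(b) + (xₖ b)° - φ(xₖ) b°`. -/
def freeAux (φ : A →ₗ[ℂ] B) : List (ℕ × A) → List (ℕ × A) → B
  | [], [] => 1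
  | _ :: _, [] => 0
  | [], (j, b) :: w => φ b * freeAux φ [] w + freeAux φ [(j, b)] w
  | (i, a) :: s, (j, b) :: w =>
    if i = j then (φ (a * b) - φ a * φ b) * freeAux φ s w + freeAux φ ((i, a * b) :: s) w
      - φ a * freeAux φ ((i, b) :: s) w
    else φ b * freeAux φ ((i, a) :: s) w + freeAux φ ((j, b) :: (i, a) :: s) w

theorem apply_smul (φ : A →ₗ[ℂ] B) (c : ℂ) (a : A) : φ (c • a) = algebraMap ℂ B c * φ a := by
  rw [map_smul, Algebra.smul_def]

/-! ### The Boolean product -/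

theorem booleanAux_comb (φ : A →ₗ[ℂ] B) (c d : B) (w w₁ w₂ : List (ℕ × A))
    (h : ∀ i a, booleanAux φ i a w = c * booleanAux φ i a w₁ + d * booleanAux φ i a w₂)
    (u : List (ℕ × A)) : ∀ i a, booleanAux φ i a (u ++ w)
      = c * booleanAux φ i a (u ++ w₁) + d * booleanAux φ i a (u ++ w₂) := by
  induction u with
  | nil => exact h
  | cons x u ih =>
    intro i a
    simp only [List.cons_append, booleanAux, ih]
    split_ifs <;> ring

theorem boolean_comb (φ : A →ₗ[ℂ] B) (c d : B) (w w₁ w₂ : List (ℕ × A))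
    (h : ∀ i a, booleanAux φ i a w = c * booleanAux φ i a w₁ + d * booleanAux φ i a w₂)
    (h' : boolean φ w = c * boolean φ w₁ + d * boolean φ w₂)
    (u : List (ℕ × A)) :
    boolean φ (u ++ w) = c * boolean φ (u ++ w₁) + d * boolean φ (u ++ w₂) := by
  cases u with
  | nil => exact h'
  | cons x u => exact booleanAux_comb φ c d w w₁ w₂ h u x.1 x.2

theorem booleanAux_add (φ : A →ₗ[ℂ] B) (i : ℕ) (w : List (ℕ × A)) : ∀ a b : A,
    booleanAux φ i (a + b) w = booleanAux φ i a w + booleanAux φ i b w := by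
  induction w with
  | nil => simp [booleanAux]
  | cons x w ih =>
    intro a b
    simp only [booleanAux, add_mul, ih, map_add]
    split_ifs <;> ring

theorem booleanAux_smul (φ : A →ₗ[ℂ] B) (i : ℕ) (w : List (ℕ × A)) (c : ℂ) : ∀ a : A,
    booleanAux φ i (c • a) w = algebraMap ℂ B c * booleanAux φ i a w := by
  induction w with
  | nil => simp only [booleanAux, apply_smul, implies_true]
  | cons x w ih =>
    intro a
    simp only [booleanAux, smul_mul_assoc, ih, apply_smul]
    split_ifs <;> ring

theorem boolean_mem (φ : A →ₗ[ℂ] B) : boolean φ ∈ multiplicative A B := by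
  refine ⟨fun u w i a b => ?_, fun u w i c a => ?_, fun u w i a b => ?_⟩
  · have := boolean_comb φ 1 1 ((i, a + b) :: w) ((i, a) :: w) ((i, b) :: w)
      (fun j x => by
        simp only [booleanAux, mul_add, booleanAux_add]
        split_ifs <;> ring)
      (by simp only [boolean, booleanAux_add]; ring) u
    simpa using this
  · have := boolean_comb φ (algebraMap ℂ B c) 0 ((i, c • a) :: w) ((i, a) :: w) []
      (fun j x => by
        simp only [booleanAux, mul_smul_comm, booleanAux_smul]
        split_ifs <;> ring)
      (by simp only [boolean, booleanAux_smul]; ring) u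
    simpa [Algebra.smul_def] using this
  · have := boolean_comb φ 1 0 ((i, a * b) :: w) ((i, a) :: (i, b) :: w) []
      (fun j x => by
        simp only [booleanAux, if_true]
        split_ifs with hij
        · subst hij; simp [mul_assoc]
        · ring)
      (by simp [boolean, booleanAux]) u
    simpa using this

theorem boolean_map (φ : A →ₗ[ℂ] B) (h : ℕ → ℕ) (s : Set ℕ) (hh : StrictMonoOn h s)
    (w : List (ℕ × A)) (hw : ∀ x ∈ w, x.1 ∈ s) :
    boolean φ (w.map fun x => (h x.1, x.2)) = boolean φ w := by
  have key : ∀ (w : List (ℕ × A)), (∀ x ∈ w, x.1 ∈ s) → ∀ i ∈ s, ∀ a,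
      booleanAux φ (h i) a (w.map fun x => (h x.1, x.2)) = booleanAux φ i a w := by
    intro w
    induction w with
    | nil => intros; rfl
    | cons x w ih =>
      intro hw i hi a
      simp only [List.forall_mem_cons] at hw
      simp only [List.map_cons, booleanAux, ih hw.2 _ hi, ih hw.2 _ hw.1,
        hh.injOn.eq_iff hi hw.1]
  cases w with
  | nil => rfl
  | cons x w =>
    simp only [List.forall_mem_cons] at hw
    exact key w hw.2 x.1 hw.1 x.2

/-! ### The monotone product -/

theorem monotoneAux_nil_cons (φ : A →ₗ[ℂ] B) (x : ℕ × A) (w : List (ℕ × A)) :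
    monotoneAux φ [] (x :: w) = monotoneAux φ [x] w := by
  rw [monotoneAux]

theorem monotoneAux_cons_cons (φ : A →ₗ[ℂ] B) (y x : ℕ × A) (s w : List (ℕ × A)) :
    monotoneAux φ (y :: s) (x :: w) =
      if y.1 < x.1 then monotoneAux φ (x :: y :: s) w
      else if y.1 = x.1 then monotoneAux φ ((y.1, y.2 * x.2) :: s) w
      else φ y.2 * monotoneAux φ s (x :: w) := by
  rw [monotoneAux]

theorem monotoneAux_comb (φ : A →ₗ[ℂ] B) (c d : B) (w w₁ w₂ : List (ℕ × A))
    (h : ∀ s, monotoneAux φ s w = c * monotoneAux φ s w₁ + d * monotoneAux φ s w₂)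
    (u : List (ℕ × A)) : ∀ s, monotoneAux φ s (u ++ w)
      = c * monotoneAux φ s (u ++ w₁) + d * monotoneAux φ s (u ++ w₂) := by
  induction u with
  | nil => exact h
  | cons x u ih =>
    intro s
    induction s with
    | nil => simp only [List.cons_append, monotoneAux_nil_cons, ih]
    | cons y s ihs =>
      simp only [List.cons_append] at ihs
      simp only [List.cons_append, monotoneAux_cons_cons, ih, ihs]
      split_ifs <;> ring

theorem monotoneAux_add (φ : A →ₗ[ℂ] B) (i : ℕ) (w : List (ℕ × A)) : ∀ (s t) (a b : A),
    monotoneAux φ (s ++ (i, a + b) :: t) w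
      = monotoneAux φ (s ++ (i, a) :: t) w + monotoneAux φ (s ++ (i, b) :: t) w := by
  induction w with
  | nil => intro s t a b; simp [monotoneAux]; ring
  | cons x w ih =>
    intro s t a b
    induction s with
    | nil =>
      have h1 := ih [(x.1, x.2)] t a b
      have h2 := ih [] t (a * x.2) (b * x.2)
      simp only [List.nil_append, List.cons_append] at h1 h2
      simp only [List.nil_append, monotoneAux_cons_cons, add_mul, h1, h2, map_add]
      split_ifs <;> ring
    | cons y s ihs =>
      have h1 := ih (x :: y :: s) t a b
      have h2 := ih ((y.1, y.2 * x.2) :: s) t a b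
      simp only [List.cons_append] at h1 h2
      simp only [List.cons_append, monotoneAux_cons_cons, h1, h2, ihs]
      split_ifs <;> ring

theorem monotoneAux_smul (φ : A →ₗ[ℂ] B) (i : ℕ) (c : ℂ) (w : List (ℕ × A)) : ∀ (s t) (a : A),
    monotoneAux φ (s ++ (i, c • a) :: t) w
      = algebraMap ℂ B c * monotoneAux φ (s ++ (i, a) :: t) w := by
  induction w with
  | nil =>
    intro s t a
    simp only [monotoneAux, List.map_append, List.map_cons, List.prod_append, List.prod_cons,
      apply_smul]
    ring
  | cons x w ih =>
    intro s t a
    induction s with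
    | nil =>
      have h1 := ih [(x.1, x.2)] t a
      have h2 := ih [] t (a * x.2)
      simp only [List.nil_append, List.cons_append] at h1 h2
      simp only [List.nil_append, monotoneAux_cons_cons, smul_mul_assoc, h1, h2, apply_smul]
      split_ifs <;> ring
    | cons y s ihs =>
      have h1 := ih (x :: y :: s) t a
      have h2 := ih ((y.1, y.2 * x.2) :: s) t a
      simp only [List.cons_append] at h1 h2
      simp only [List.cons_append, monotoneAux_cons_cons, h1, h2, ihs]
      split_ifs <;> ring

theorem monotoneAux_mem (φ : A →ₗ[ℂ] B) : monotoneAux φ [] ∈ multiplicative A B := by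
  refine ⟨fun u w i a b => ?_, fun u w i c a => ?_, fun u w i a b => ?_⟩
  · have := monotoneAux_comb φ 1 1 ((i, a + b) :: w) ((i, a) :: w) ((i, b) :: w)
      (fun s => by
        induction s with
        | nil => simpa [monotoneAux_nil_cons] using monotoneAux_add φ i w [] [] a b
        | cons y s ihs =>
          have h1 := monotoneAux_add φ i w [] (y :: s) a b
          have h2 := monotoneAux_add φ y.1 w [] s (y.2 * a) (y.2 * b)
          simp only [List.nil_append] at h1 h2
          simp only [monotoneAux_cons_cons, mul_add, h1, h2, ihs]
          split_ifs <;> ring) u []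
    simpa using this
  · have := monotoneAux_comb φ (algebraMap ℂ B c) 0 ((i, c • a) :: w) ((i, a) :: w) []
      (fun s => by
        induction s with
        | nil => simpa [monotoneAux_nil_cons] using monotoneAux_smul φ i c w [] [] a
        | cons y s ihs =>
          have h1 := monotoneAux_smul φ i c w [] (y :: s) a
          have h2 := monotoneAux_smul φ y.1 c w [] s (y.2 * a)
          simp only [List.nil_append] at h1 h2
          simp only [monotoneAux_cons_cons, mul_smul_comm, h1, h2, ihs]
          split_ifs <;> ring) u []
    simpa [Algebra.smul_def] using this
  · have := monotoneAux_comb φ 1 0 ((i, a * b) :: w) ((i, a) :: (i, b) :: w) []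
      (fun s => by
        induction s with
        | nil => simp [monotoneAux_nil_cons, monotoneAux_cons_cons]
        | cons y s ihs =>
          rw [monotoneAux_cons_cons, ihs, monotoneAux_cons_cons φ y (i, a)]
          split_ifs with h1 h2
          · simp [monotoneAux_cons_cons]
          · subst h2; simp [monotoneAux_cons_cons, mul_assoc]
          · ring) u []
    simpa using this

theorem monotoneAux_map (φ : A →ₗ[ℂ] B) (h : ℕ → ℕ) (S : Set ℕ) (hh : StrictMonoOn h S)
    (w : List (ℕ × A)) : (∀ x ∈ w, x.1 ∈ S) → ∀ s : List (ℕ × A), (∀ x ∈ s, x.1 ∈ S) →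
    monotoneAux φ (s.map fun x => (h x.1, x.2)) (w.map fun x => (h x.1, x.2))
      = monotoneAux φ s w := by
  induction w with
  | nil => intro _ s _; simp [monotoneAux, Function.comp_def]
  | cons x w ih =>
    intro hw s
    have hw' := List.forall_mem_cons.1 hw
    induction s with
    | nil =>
      intro _
      simpa [monotoneAux_nil_cons] using ih hw'.2 [x] (by simpa using hw'.1)
    | cons y s ihs =>
      intro hs
      have hs' := List.forall_mem_cons.1 hs
      have h1 := ih hw'.2 (x :: y :: s) (by simp; exact ⟨hw'.1, hs'.1, by simpa using hs'.2⟩)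
      have h2 := ih hw'.2 ((y.1, y.2 * x.2) :: s) (by simp; exact ⟨hs'.1, by simpa using hs'.2⟩)
      have h3 := ihs hs'.2
      simp only [List.map_cons] at h1 h2 h3
      simp only [List.map_cons, monotoneAux_cons_cons, h1, h2, h3,
        hh.injOn.eq_iff hs'.1 hw'.1, hh.lt_iff_lt hs'.1 hw'.1]

/-! ### The free product -/

theorem freeAux_comb (φ : A →ₗ[ℂ] B) (c d : B) (w w₁ w₂ : List (ℕ × A))
    (h : ∀ s, Alternating s → freeAux φ s w = c * freeAux φ s w₁ + d * freeAux φ s w₂)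
    (u : List (ℕ × A)) : ∀ s, Alternating s → freeAux φ s (u ++ w)
      = c * freeAux φ s (u ++ w₁) + d * freeAux φ s (u ++ w₂) := by
  induction u with
  | nil => exact h
  | cons x u ih =>
    intro s hs
    cases s with
    | nil =>
      have h1 := ih [] (by simp [Alternating])
      have h2 := ih [x] (by simp [Alternating])
      simp only [List.cons_append, freeAux, h1, h2]
      ring
    | cons y s =>
      obtain ⟨i, a⟩ := y
      obtain ⟨j, b⟩ := x
      simp only [List.cons_append, freeAux]
      split_ifs with hij
      · rw [ih _ hs.tail, ih _ (hs.change (a * b)), ih _ (hs.change b)]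
        ring
      · rw [ih _ hs, ih ((j, b) :: (i, a) :: s) (List.IsChain.cons_cons (Ne.symm hij) hs)]
        ring

theorem freeAux_add (φ : A →ₗ[ℂ] B) (i : ℕ) (w : List (ℕ × A)) : ∀ (s t) (a b : A),
    freeAux φ (s ++ (i, a + b) :: t) w
      = freeAux φ (s ++ (i, a) :: t) w + freeAux φ (s ++ (i, b) :: t) w := by
  induction w with
  | nil => intro s t a b; cases s <;> simp [freeAux]
  | cons x w ih =>
    intro s t a b
    cases s with
    | nil =>
      have h0 := ih [] t a b
      have h1 := ih [x] t a b
      have h2 := ih [] t (a * x.2) (b * x.2)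
      simp only [List.nil_append, List.cons_append] at h0 h1 h2
      simp only [List.nil_append, freeAux, add_mul, h0, h1, h2, map_add]
      split_ifs <;> ring
    | cons y s =>
      have h0 := ih s t a b
      have h1 := ih (x :: y :: s) t a b
      have h2 := ih ((y.1, y.2 * x.2) :: s) t a b
      have h3 := ih (y :: s) t a b
      have h4 := ih ((y.1, x.2) :: s) t a b
      simp only [List.cons_append] at h1 h2 h3 h4
      simp only [List.cons_append, freeAux, h0, h1, h2, h3, h4]
      split_ifs <;> ring

theorem freeAux_smul (φ : A →ₗ[ℂ] B) (i : ℕ) (c : ℂ) (w : List (ℕ × A)) : ∀ (s t) (a : A),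
    freeAux φ (s ++ (i, c • a) :: t) w
      = algebraMap ℂ B c * freeAux φ (s ++ (i, a) :: t) w := by
  induction w with
  | nil => intro s t a; cases s <;> simp [freeAux]
  | cons x w ih =>
    intro s t a
    cases s with
    | nil =>
      have h0 := ih [] t a
      have h1 := ih [x] t a
      have h2 := ih [] t (a * x.2)
      simp only [List.nil_append, List.cons_append] at h0 h1 h2
      simp only [List.nil_append, freeAux, smul_mul_assoc, h0, h1, h2, apply_smul]
      split_ifs <;> ring
    | cons y s =>
      have h0 := ih s t a
      have h1 := ih (x :: y :: s) t a
      have h2 := ih ((y.1, y.2 * x.2) :: s) t a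
      have h3 := ih (y :: s) t a
      have h4 := ih ((y.1, x.2) :: s) t a
      simp only [List.cons_append] at h1 h2 h3 h4
      simp only [List.cons_append, freeAux, h0, h1, h2, h3, h4]
      split_ifs <;> ring

theorem freeAux_one (φ : A →ₗ[ℂ] B) (hφ : φ 1 = 1) (i : ℕ) (w : List (ℕ × A)) : ∀ s t,
    freeAux φ (s ++ (i, 1) :: t) w = 0 := by
  induction w with
  | nil => intro s t; cases s <;> simp [freeAux]
  | cons x w ih =>
    intro s t
    cases s with
    | nil =>
      have h0 := ih [] t
      have h1 := ih [x] t
      simp only [List.nil_append, List.cons_append] at h0 h1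
      simp [freeAux, h0, h1, hφ]
    | cons y s =>
      have h0 := ih s t
      have h1 := ih (x :: y :: s) t
      have h2 := ih ((y.1, y.2 * x.2) :: s) t
      have h3 := ih (y :: s) t
      have h4 := ih ((y.1, x.2) :: s) t
      simp only [List.cons_append] at h1 h2 h3 h4
      simp [List.cons_append, freeAux, h0, h1, h2, h3, h4]

theorem freeAux_mem (φ : A →ₗ[ℂ] B) (hφ : φ 1 = 1) (s₀ : List (ℕ × A)) (hs₀ : Alternating s₀) :
    freeAux φ s₀ ∈ unital A B := by
  refine ⟨⟨fun u w i a b => ?_, fun u w i c a => ?_, fun u w i a b => ?_⟩, fun u w i => ?_⟩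
  · have := freeAux_comb φ 1 1 ((i, a + b) :: w) ((i, a) :: w) ((i, b) :: w)
      (fun s _ => by
        have h1 := freeAux_add φ i w [] s a b
        rw [List.nil_append, List.nil_append, List.nil_append] at h1
        cases s with
        | nil => simp only [freeAux, map_add, h1]; ring
        | cons y s =>
          have h2 := freeAux_add φ y.1 w [] s (y.2 * a) (y.2 * b)
          have h3 := freeAux_add φ y.1 w [] s a b
          simp only [List.nil_append] at h2 h3
          simp only [freeAux, mul_add, map_add, h1, h2, h3]
          split_ifs <;> ring) u s₀ hs₀
    simpa using this
  · have := freeAux_comb φ (algebraMap ℂ B c) 0 ((i, c • a) :: w) ((i, a) :: w) []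
      (fun s _ => by
        have h1 := freeAux_smul φ i c w [] s a
        rw [List.nil_append, List.nil_append] at h1
        cases s with
        | nil => simp only [freeAux, apply_smul, h1]; ring
        | cons y s =>
          have h2 := freeAux_smul φ y.1 c w [] s (y.2 * a)
          have h3 := freeAux_smul φ y.1 c w [] s a
          simp only [List.nil_append] at h2 h3
          simp only [freeAux, mul_smul_comm, apply_smul, h1, h2, h3]
          split_ifs <;> ring) u s₀ hs₀
    simpa [Algebra.smul_def] using this
  · have := freeAux_comb φ 1 0 ((i, a * b) :: w) ((i, a) :: (i, b) :: w) []
      (fun s hs => by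
        cases s with
        | nil => simp only [freeAux, if_true]; ring
        | cons y s =>
          obtain ⟨j, x⟩ := y
          simp only [freeAux]
          split_ifs with hij
          · subst hij
            have hs' : freeAux φ s ((j, b) :: w)
                = φ b * freeAux φ s w + freeAux φ ((j, b) :: s) w := by
              cases s with
              | nil => simp only [freeAux]
              | cons z s =>
                have hz : j ≠ z.1 := by simpa [Alternating] using (List.isChain_cons_cons.1 hs).1
                simp only [freeAux, if_neg hz.symm]
            simp only [hs', mul_assoc]
            ring
          · ring) u s₀ hs₀
    simpa using this
  · have := freeAux_comb φ 1 0 ((i, 1) :: w) w []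
      (fun s _ => by
        have h1 := freeAux_one φ hφ i w [] s
        rw [List.nil_append] at h1
        cases s with
        | nil => simp [freeAux, hφ, h1]
        | cons y s =>
          have h2 := freeAux_one φ hφ y.1 w [] s
          rw [List.nil_append] at h2
          simp only [freeAux, mul_one, hφ, h1, h2]
          split_ifs <;> ring) u s₀ hs₀
    simpa using this

theorem freeAux_map (φ : A →ₗ[ℂ] B) (h : ℕ → ℕ) (S : Set ℕ) (hh : StrictMonoOn h S)
    (w : List (ℕ × A)) : (∀ x ∈ w, x.1 ∈ S) → ∀ s : List (ℕ × A), (∀ x ∈ s, x.1 ∈ S) →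
    freeAux φ (s.map fun x => (h x.1, x.2)) (w.map fun x => (h x.1, x.2)) = freeAux φ s w := by
  induction w with
  | nil => intro _ s _; cases s <;> simp [freeAux]
  | cons x w ih =>
    intro hw s hs
    have hw' := List.forall_mem_cons.1 hw
    cases s with
    | nil =>
      have h1 := ih hw'.2 [] (by simp)
      have h2 := ih hw'.2 [x] (by simpa using hw'.1)
      simp only [List.map_cons, List.map_nil] at h1 h2
      simp only [List.map_cons, List.map_nil, freeAux, h1, h2]
    | cons y s =>
      have hs' := List.forall_mem_cons.1 hs
      have h0 := ih hw'.2 s hs'.2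
      have h1 := ih hw'.2 (x :: y :: s) (List.forall_mem_cons.2 ⟨hw'.1, hs⟩)
      have h2 := ih hw'.2 ((y.1, y.2 * x.2) :: s) (List.forall_mem_cons.2 ⟨hs'.1, hs'.2⟩)
      have h3 := ih hw'.2 (y :: s) hs
      have h4 := ih hw'.2 ((y.1, x.2) :: s) (List.forall_mem_cons.2 ⟨hs'.1, hs'.2⟩)
      simp only [List.map_cons] at h0 h1 h2 h3 h4
      simp only [List.map_cons, freeAux, h0, h1, h2, h3, h4, hh.injOn.eq_iff hs'.1 hw'.1]

end Words

namespace Words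

variable {A : Type u} {B : Type v} [Ring A] [Algebra ℂ A] [CommRing B] [Algebra ℂ B]

/-- The free product of countably many copies of `φ`. -/
noncomputable def freeExpect (φ : A →ₗ[ℂ] B) (hφ : φ 1 = 1) : FreeProd A →ₗ[ℂ] B :=
  lift ⟨freeAux φ [], freeAux_mem φ hφ [] List.isChain_nil⟩

/-- The Boolean product of countably many copies of `φ`. -/
noncomputable def booleanExpect (φ : A →ₗ[ℂ] B) : FreeProd₀ A →ₗ[ℂ] B :=
  lift₀ ⟨boolean φ, boolean_mem φ⟩

/-- The monotone product of countably many copies of `φ`. -/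
noncomputable def monotoneExpect (φ : A →ₗ[ℂ] B) : FreeProd₀ A →ₗ[ℂ] B :=
  lift₀ ⟨monotoneAux φ [], monotoneAux_mem φ⟩

theorem freeExpect_word (φ : A →ₗ[ℂ] B) (hφ : φ 1 = 1) (w : List (ℕ × A)) :
    freeExpect φ hφ (w.map fun x => emb x.1 x.2).prod = freeAux φ [] w :=
  lift_word _ w

theorem booleanExpect_word (φ : A →ₗ[ℂ] B) (w : List (ℕ × A)) :
    booleanExpect φ (w.map fun x => emb₀ x.1 x.2).prod = boolean φ w :=
  lift₀_word _ w

theorem monotoneExpect_word (φ : A →ₗ[ℂ] B) (w : List (ℕ × A)) :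
    monotoneExpect φ (w.map fun x => emb₀ x.1 x.2).prod = monotoneAux φ [] w :=
  lift₀_word _ w

/-! ### The defining rules of the products -/

/-- The rule of the Boolean product. -/
theorem booleanExpect_alternating (φ : A →ₗ[ℂ] B) (w : List (ℕ × A)) (hw : Alternating w) :
    booleanExpect φ (w.map fun x => emb₀ x.1 x.2).prod = (w.map fun x => φ x.2).prod := by
  rw [booleanExpect_word]
  cases w with
  | nil => rfl
  | cons x w =>
    change booleanAux φ x.1 x.2 w = _
    induction w generalizing x with
    | nil => simp [booleanAux]
    | cons y w ih =>
      have h := List.isChain_cons_cons.1 hw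
      rw [booleanAux, if_neg h.1, ih y h.2]
      simp

/-- The rule of the monotone product for a peak at the beginning. -/
theorem monotoneExpect_first (φ : A →ₗ[ℂ] B) {i j : ℕ} (hij : j < i) (a b : A)
    (w : List (ℕ × A)) :
    monotoneExpect φ (((i, a) :: (j, b) :: w).map fun x => emb₀ x.1 x.2).prod
      = φ a * monotoneExpect φ (((j, b) :: w).map fun x => emb₀ x.1 x.2).prod := by
  rw [monotoneExpect_word, monotoneExpect_word, monotoneAux_nil_cons, monotoneAux_cons_cons,
    if_neg (by simp; omega), if_neg (by simp; omega)]

/-- The rule of the monotone product for a peak at the end. -/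
theorem monotoneExpect_last (φ : A →ₗ[ℂ] B) {i j : ℕ} (hij : i < j) (a b : A)
    (w : List (ℕ × A)) :
    monotoneExpect φ ((w ++ [(i, a), (j, b)]).map fun x => emb₀ x.1 x.2).prod
      = monotoneExpect φ ((w ++ [(i, a)]).map fun x => emb₀ x.1 x.2).prod * φ b := by
  rw [monotoneExpect_word, monotoneExpect_word]
  have := monotoneAux_comb φ (φ b) 0 [(i, a), (j, b)] [(i, a)] [] (fun s => by
    induction s with
    | nil => simp [monotoneAux_nil_cons, monotoneAux_cons_cons, hij, monotoneAux]
    | cons y s ih =>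
      rw [monotoneAux_cons_cons, ih, monotoneAux_cons_cons φ y]
      split_ifs with h1 h2
      · simp [monotoneAux_cons_cons, hij, monotoneAux]
      · subst h2; simp [monotoneAux_cons_cons, hij, monotoneAux]
      · ring) w []
  rw [this]
  ring

/-- The rule of the monotone product for a peak in the middle. -/
theorem monotoneExpect_middle (φ : A →ₗ[ℂ] B) {i j k : ℕ} (hij : i < j) (hkj : k < j) (a b c : A)
    (u w : List (ℕ × A)) :
    monotoneExpect φ ((u ++ (i, a) :: (j, b) :: (k, c) :: w).map fun x => emb₀ x.1 x.2).prod
      = monotoneExpect φ ((u ++ (i, a) :: (k, c) :: w).map fun x => emb₀ x.1 x.2).prod * φ b := by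
  rw [monotoneExpect_word, monotoneExpect_word]
  have h3 : ¬ j < k := by omega
  have h4 : ¬ j = k := by omega
  have := monotoneAux_comb φ (φ b) 0 ((i, a) :: (j, b) :: (k, c) :: w) ((i, a) :: (k, c) :: w) []
    (fun s => by
      induction s with
      | nil =>
        rw [monotoneAux_nil_cons, monotoneAux_cons_cons, if_pos hij, monotoneAux_cons_cons,
          if_neg h3, if_neg h4, monotoneAux_nil_cons]
        ring
      | cons y s ih =>
        rw [monotoneAux_cons_cons, ih, monotoneAux_cons_cons φ y]
        split_ifs with h1 h2
        · rw [monotoneAux_cons_cons, if_pos hij, monotoneAux_cons_cons, if_neg h3, if_neg h4]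
          ring
        · subst h2
          rw [monotoneAux_cons_cons, if_pos hij, monotoneAux_cons_cons, if_neg h3, if_neg h4]
          ring
        · ring) u []
  rw [this]
  ring

theorem freeProd_induction {p : FreeProd A → Prop}
    (word : ∀ w : List (ℕ × A), p (w.map fun x => emb x.1 x.2).prod)
    (add : ∀ x y, p x → p y → p (x + y)) (smul : ∀ (c : ℂ) x, p x → p (c • x))
    (x : FreeProd A) : p x := by
  let M : Submonoid (FreeProd A) :=
    { carrier := Set.range fun w : List (ℕ × A) => (w.map fun x => emb x.1 x.2).prod
      one_mem' := ⟨[], rfl⟩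
      mul_mem' := by
        rintro _ _ ⟨w, rfl⟩ ⟨w', rfl⟩
        exact ⟨w ++ w', by simp⟩ }
  let T : Subalgebra ℂ (FreeProd A) := Algebra.adjoin ℂ (M : Set (FreeProd A))
  have hT : ∀ i a, emb (A := A) i a ∈ T := fun i a =>
    Algebra.subset_adjoin ⟨[(i, a)], by simp⟩
  let F : FreeProd A →ₐ[ℂ] T := LinearAlgebra.FreeProduct.lift ℂ (fun _ : ℕ => A)
    (fun {i} => (emb (A := A) i).codRestrict T (hT i))
  have hF : T.val.comp F = AlgHom.id ℂ (FreeProd A) := by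
    apply (LinearAlgebra.FreeProduct.lift ℂ (fun _ : ℕ => A)).symm.injective
    funext i
    refine AlgHom.ext fun a => ?_
    have : F (emb i a) = (emb (A := A) i).codRestrict T (hT i) a :=
      DFunLike.congr_fun (LinearAlgebra.FreeProduct.lift_comp_ι (i := i) ℂ (fun _ : ℕ => A)
        (fun {i} => (emb (A := A) i).codRestrict T (hT i))) a
    change ((F (emb i a) : T) : FreeProd A) = emb i a
    rw [this]
    rfl
  have hx : x ∈ T := by
    have := DFunLike.congr_fun hF x
    change ((F x : T) : FreeProd A) = x at this
    rw [← this]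
    exact (F x).2
  have hx' : x ∈ Submodule.span ℂ (M : Set (FreeProd A)) := by
    have h := Algebra.adjoin_eq_span ℂ (M : Set (FreeProd A))
    rw [Submonoid.closure_eq] at h
    rw [← h]
    exact hx
  clear hx
  induction hx' using Submodule.span_induction with
  | mem x hx => obtain ⟨w, rfl⟩ := hx; exact word w
  | zero => simpa using smul 0 _ (word [])
  | add x y _ _ hx hy => exact add x y hx hy
  | smul c x _ hx => exact smul c x hx

theorem liftBaseChange_centred (φ : A →ₗ[ℂ] B) (hφ : φ 1 = 1) (x : ℕ × A) (s : List (ℕ × A))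
    (hs : Alternating s) (hxs : Alternating (x :: s)) (z : B ⊗[ℂ] FreeProd A) :
    (lift ⟨freeAux φ s, freeAux_mem φ hφ s hs⟩).liftBaseChange B
        (((1 : B) ⊗ₜ[ℂ] emb x.1 x.2 - φ x.2 ⊗ₜ[ℂ] (1 : FreeProd A)) * z)
      = (lift ⟨freeAux φ (x :: s), freeAux_mem φ hφ _ hxs⟩).liftBaseChange B z := by
  have hstep : ∀ u : FreeProd A,
      lift ⟨freeAux φ s, freeAux_mem φ hφ s hs⟩ (emb x.1 x.2 * u)
        = φ x.2 * lift ⟨freeAux φ s, freeAux_mem φ hφ s hs⟩ u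
          + lift ⟨freeAux φ (x :: s), freeAux_mem φ hφ _ hxs⟩ u := by
    intro u
    induction u using freeProd_induction with
    | word w =>
      have h := lift_word ⟨freeAux φ s, freeAux_mem φ hφ s hs⟩ (x :: w)
      rw [List.map_cons, List.prod_cons] at h
      rw [h, lift_word, lift_word]
      cases s with
      | nil => simp only [freeAux]
      | cons y s =>
        have hy : ¬ y.1 = x.1 := fun h => (List.isChain_cons_cons.1 hxs).1 h.symm
        simp only [freeAux, if_neg hy]
    | add u v hu hv => rw [mul_add, map_add, map_add, map_add, hu, hv]; ring
    | smul c u hu =>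
      rw [mul_smul_comm, map_smul, map_smul, map_smul, hu, smul_add, mul_smul_comm]
  induction z using TensorProduct.induction_on with
  | zero => simp
  | tmul b u =>
    rw [sub_mul, Algebra.TensorProduct.tmul_mul_tmul, Algebra.TensorProduct.tmul_mul_tmul, map_sub,
      LinearMap.liftBaseChange_tmul, LinearMap.liftBaseChange_tmul, LinearMap.liftBaseChange_tmul,
      hstep, one_mul, one_mul]
    simp only [smul_eq_mul]
    ring
  | add y z hy hz => rw [mul_add, map_add, map_add, hy, hz]

/-- The rule of the free product: its `B`-linear extension vanishes on the alternating products of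
centred elements `x - φ(x)`. -/
theorem freeExpect_alternating (φ : A →ₗ[ℂ] B) (hφ : φ 1 = 1) (w : List (ℕ × A))
    (hw : Alternating w) (hne : w ≠ []) :
    (freeExpect φ hφ).liftBaseChange B
      (w.map fun x => (1 : B) ⊗ₜ[ℂ] emb x.1 x.2 - φ x.2 ⊗ₜ[ℂ] (1 : FreeProd A)).prod = 0 := by
  have key : ∀ (w s : List (ℕ × A)) (hs : Alternating s), Alternating (w.reverse ++ s) →
      w.reverse ++ s ≠ [] →
      (lift ⟨freeAux φ s, freeAux_mem φ hφ s hs⟩).liftBaseChange B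
        (w.map fun x => (1 : B) ⊗ₜ[ℂ] emb x.1 x.2 - φ x.2 ⊗ₜ[ℂ] (1 : FreeProd A)).prod = 0 := by
    intro w
    induction w with
    | nil =>
      intro s hs _ hne
      have h := lift_word ⟨freeAux φ s, freeAux_mem φ hφ s hs⟩ []
      rw [List.map_nil, List.prod_nil] at h
      rw [List.map_nil, List.prod_nil, Algebra.TensorProduct.one_def,
        LinearMap.liftBaseChange_tmul, h]
      cases s with
      | nil => simp at hne
      | cons y s => simp [freeAux]
    | cons x w ih =>
      intro s hs hws hne
      rw [List.reverse_cons, List.append_assoc, List.singleton_append] at hws hne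
      have hxs : Alternating (x :: s) := List.IsChain.right_of_append hws
      rw [List.map_cons, List.prod_cons, liftBaseChange_centred φ hφ x s hs hxs]
      exact ih _ hxs hws hne
  refine key w [] List.isChain_nil ?_ (by simpa using hne)
  rw [List.append_nil, Alternating, List.isChain_reverse]
  exact hw.imp fun _ _ h => h.symm

end Words

namespace InfiniteTensor

variable {A : Type u} {B : Type v} [Ring A] [Algebra ℂ A] [CommRing B] [Algebra ℂ B]

/-- The algebraic infinite tensor product of copies of `A`: the subalgebra of `⨂ (_ : ℕ), A`
generated by the elements `1 ⊗ ⋯ ⊗ 1 ⊗ a ⊗ 1 ⊗ ⋯`. -/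
noncomputable abbrev algebra (A : Type u) [Ring A] [Algebra ℂ A] :
    Subalgebra ℂ (⨂[ℂ] _ : ℕ, A) :=
  ⨆ j : ℕ, (PiTensorProduct.singleAlgHom (R := ℂ) (A := fun _ : ℕ => A) j).range

/-- The embedding of `A` as the `j`-th tensor component. -/
noncomputable def emb (j : ℕ) : A →ₐ[ℂ] algebra A :=
  (PiTensorProduct.singleAlgHom (R := ℂ) (A := fun _ : ℕ => A) j).codRestrict (algebra A)
    fun a => le_iSup (fun j : ℕ =>
      (PiTensorProduct.singleAlgHom (R := ℂ) (A := fun _ : ℕ => A) j).range) j ⟨a, rfl⟩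

theorem finite_update (a : ℕ → A) (j : ℕ) (x : A) :
    {k | Function.update a j x k ≠ 1}.Finite ↔ {k | k ≠ j ∧ a k ≠ 1}.Finite := by
  constructor
  · refine fun h => h.subset fun k hk => ?_
    simpa [Function.update_of_ne hk.1] using hk.2
  · refine fun h => (h.insert j).subset fun k hk => ?_
    by_cases hkj : k = j
    · exact Or.inl hkj
    · exact Or.inr ⟨hkj, by simpa [Function.update_of_ne hkj] using hk⟩

theorem finprod_update (φ : A →ₗ[ℂ] B) (hφ : φ 1 = 1) (a : ℕ → A) (j : ℕ) (x : A)
    (h : {k | k ≠ j ∧ a k ≠ 1}.Finite) :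
    ∏ᶠ k, φ (Function.update a j x k) = φ x * ∏ k ∈ h.toFinset, φ (a k) := by
  classical
  rw [finprod_eq_prod_of_mulSupport_subset (s := insert j h.toFinset), Finset.prod_insert (by simp),
    Function.update_self]
  · congr 1
    refine Finset.prod_congr rfl fun k hk => ?_
    rw [Function.update_of_ne]
    simp at hk
    exact hk.1
  · intro k hk
    by_cases hkj : k = j
    · simp [hkj]
    · refine Finset.mem_coe.2 (Finset.mem_insert_of_mem ?_)
      rw [Set.Finite.mem_toFinset]
      refine ⟨hkj, fun h1 => hk ?_⟩
      simp [Function.update_of_ne hkj, h1, hφ]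

open scoped Classical in
/-- The multilinear map `(aⱼ) ↦ ∏ⱼ φ(aⱼ)` on the families with only finitely many `aⱼ ≠ 1`. The
value `0` is used on all other families. -/
noncomputable def prodMap (φ : A →ₗ[ℂ] B) (hφ : φ 1 = 1) :
    MultilinearMap ℂ (fun _ : ℕ => A) B where
  toFun a := if {j | a j ≠ 1}.Finite then ∏ᶠ j, φ (a j) else 0
  map_update_add' {inst} a j x y := by
    rw [Subsingleton.elim inst (instDecidableEqNat)]
    simp only [finite_update]
    split_ifs with h
    · rw [finprod_update φ hφ a j _ h, finprod_update φ hφ a j _ h, finprod_update φ hφ a j _ h,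
        map_add, add_mul]
    · simp
  map_update_smul' {inst} a j c x := by
    rw [Subsingleton.elim inst (instDecidableEqNat)]
    simp only [finite_update]
    split_ifs with h
    · rw [finprod_update φ hφ a j _ h, finprod_update φ hφ a j _ h, map_smul, smul_mul_assoc]
    · simp

/-- The infinite tensor product of copies of `φ`. -/
noncomputable def expect (φ : A →ₗ[ℂ] B) (hφ : φ 1 = 1) : algebra A →ₗ[ℂ] B :=
  (PiTensorProduct.lift (prodMap φ hφ)).comp (algebra A).val.toLinearMap

/-- The product of the letters of a word from the `j`-th copy, in order. -/
def component (w : List (ℕ × A)) (j : ℕ) : A :=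
  ((w.filter fun x => x.1 = j).map fun x => x.2).prod

theorem val_word (w : List (ℕ × A)) :
    ((w.map fun x => emb x.1 x.2).prod : ⨂[ℂ] _ : ℕ, A)
      = PiTensorProduct.tprod ℂ (component w) := by
  induction w with
  | nil => rfl
  | cons x w ih =>
    have h : ((emb x.1 x.2 : algebra A) : ⨂[ℂ] _ : ℕ, A)
        = PiTensorProduct.tprod ℂ (Pi.mulSingle x.1 x.2) := rfl
    have hc : component (x :: w) = Pi.mulSingle x.1 x.2 * component w := by
      funext j
      by_cases hj : x.1 = j
      · subst hj
        simp [component]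
      · simp [component, hj, Pi.mulSingle_eq_of_ne (Ne.symm hj)]
    rw [List.map_cons, List.prod_cons, MulMemClass.coe_mul, ih, h,
      PiTensorProduct.tprod_mul_tprod, hc]

theorem component_eq_one (w : List (ℕ × A)) (j : ℕ) (hj : ∀ x ∈ w, x.1 ≠ j) :
    component w j = 1 := by
  have : w.filter (fun x => x.1 = j) = [] := by
    rw [List.filter_eq_nil_iff]
    intro x hx
    simpa using hj x hx
  rw [component, this]
  rfl

theorem component_support (w : List (ℕ × A)) :
    {j | component w j ≠ 1} ⊆ (w.map fun x => x.1).toFinset := by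
  intro j hj
  by_contra h
  refine hj (component_eq_one w j fun x hx hxj => h ?_)
  simp only [List.coe_toFinset, List.mem_map, Set.mem_setOf_eq]
  exact ⟨x, hx, hxj⟩

theorem finite_component (w : List (ℕ × A)) : {j | component w j ≠ 1}.Finite :=
  (Finset.finite_toSet _).subset (component_support w)

/-- The rule of the tensor product. -/
theorem expect_word (φ : A →ₗ[ℂ] B) (hφ : φ 1 = 1) (w : List (ℕ × A)) :
    expect φ hφ (w.map fun x => emb x.1 x.2).prod = ∏ᶠ j, φ (component w j) := by
  change PiTensorProduct.lift (prodMap φ hφ)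
    (((w.map fun x => emb x.1 x.2).prod : algebra A) : ⨂[ℂ] _ : ℕ, A) = _
  rw [val_word, PiTensorProduct.lift.tprod]
  exact if_pos (finite_component w)

theorem expect_map (φ : A →ₗ[ℂ] B) (hφ : φ 1 = 1) (h : ℕ → ℕ) (S : Set ℕ) (hh : StrictMonoOn h S)
    (w : List (ℕ × A)) (hw : ∀ x ∈ w, x.1 ∈ S) :
    ∏ᶠ j, φ (component (w.map fun x => (h x.1, x.2)) j) = ∏ᶠ j, φ (component w j) := by
  classical
  have hsupp : ∀ w : List (ℕ × A), Function.mulSupport (fun j => φ (component w j))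
      ⊆ (w.map fun x => x.1).toFinset := fun w j hj =>
    component_support w fun h1 => hj (by simp [h1, hφ])
  have hI : ∀ j ∈ (w.map fun x => x.1).toFinset, j ∈ S := by
    intro j hj
    simp only [List.mem_toFinset, List.mem_map] at hj
    obtain ⟨x, hx, rfl⟩ := hj
    exact hw x hx
  have himg : ((w.map fun x => (h x.1, x.2)).map fun x => x.1).toFinset
      = (w.map fun x => x.1).toFinset.image h := by
    ext j
    simp
  rw [finprod_eq_prod_of_mulSupport_subset _ (hsupp _),
    finprod_eq_prod_of_mulSupport_subset _ (hsupp _), himg,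
    Finset.prod_image fun j hj k hk => hh.injOn (hI j hj) (hI k hk)]
  refine Finset.prod_congr rfl fun j hj => ?_
  congr 1
  rw [component, component, List.filter_map, List.map_map]
  congr 2
  refine List.filter_congr fun x hx => ?_
  simp [hh.injOn.eq_iff (hw x hx) (hI j hj)]

end InfiniteTensor

section Systems

variable {A : Type u} {B : Type v} [Ring A] [Algebra ℂ A] [CommRing B] [Algebra ℂ B]
  (φ : A →ₗ[ℂ] B) (hφ : φ 1 = 1)

theorem ofFn_emb {U : Type u} [Ring U] {n : ℕ} (e : ℕ → A → U) (i : Fin n → ℕ) (X : Fin n → A) :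
    (List.ofFn fun k => e (i k) (X k)).prod
      = ((List.ofFn fun k => (i k, X k)).map fun x : ℕ × A => e x.1 x.2).prod := by
  rw [List.map_ofFn]
  rfl

theorem ofFn_relabel {n : ℕ} (h : ℕ → ℕ) (i : Fin n → ℕ) (X : Fin n → A) :
    (List.ofFn fun k => (h (i k), X k))
      = (List.ofFn fun k => (i k, X k)).map fun x : ℕ × A => (h x.1, x.2) := by
  rw [List.map_ofFn]
  rfl

theorem ofFn_mem_range {n : ℕ} (i : Fin n → ℕ) (X : Fin n → A) :
    ∀ x ∈ List.ofFn fun k => (i k, X k), x.1 ∈ Set.range i := by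
  intro x hx
  obtain ⟨k, rfl⟩ := List.mem_ofFn' _ _ |>.1 hx
  exact ⟨k, rfl⟩

/-- The tensor spreadability system. -/
noncomputable def tensorSystem : SpreadabilitySystem φ where
  U := InfiniteTensor.algebra A
  expect := InfiniteTensor.expect φ hφ
  expect_one := by
    have := InfiniteTensor.expect_word φ hφ []
    simpa [InfiniteTensor.component, hφ] using this
  emb j := (InfiniteTensor.emb (A := A) j).toNonUnitalAlgHom
  expect_emb j X := by
    have := InfiniteTensor.expect_word φ hφ [(j, X)]
    rw [finprod_eq_single _ j fun k hk => by
      rw [InfiniteTensor.component_eq_one _ k (by simpa using hk.symm), hφ]] at this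
    exact (by simpa [InfiniteTensor.component] using this :
      InfiniteTensor.expect φ hφ (InfiniteTensor.emb j X) = φ X)
  spread n X i h hh := by
    have e := fun i : Fin n → ℕ => ofFn_emb (fun j a => InfiniteTensor.emb (A := A) j a) i X
    refine (congrArg _ (e i)).trans (Eq.trans ?_ (congrArg _ (e fun k => h (i k))).symm)
    rw [ofFn_relabel, InfiniteTensor.expect_word, InfiniteTensor.expect_word,
      InfiniteTensor.expect_map φ hφ h _ hh _ (ofFn_mem_range i X)]

/-- The free spreadability system. -/
noncomputable def freeSystem : SpreadabilitySystem φ where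
  U := Words.FreeProd A
  expect := Words.freeExpect φ hφ
  expect_one := by
    have := Words.freeExpect_word φ hφ []
    simpa [Words.freeAux] using this
  emb j := (Words.emb (A := A) j).toNonUnitalAlgHom
  expect_emb j X := by
    have := Words.freeExpect_word φ hφ [(j, X)]
    exact (by simpa [Words.freeAux] using this :
      Words.freeExpect φ hφ (Words.emb j X) = φ X)
  spread n X i h hh := by
    have e := fun i : Fin n → ℕ => ofFn_emb (fun j a => Words.emb (A := A) j a) i X
    refine (congrArg _ (e i)).trans (Eq.trans ?_ (congrArg _ (e fun k => h (i k))).symm)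
    rw [ofFn_relabel, Words.freeExpect_word, Words.freeExpect_word]
    exact (Words.freeAux_map φ h _ hh _ (ofFn_mem_range i X) [] (by simp)).symm

/-- The Boolean spreadability system. -/
noncomputable def booleanSystem : SpreadabilitySystem φ where
  U := Words.FreeProd₀ A
  expect := Words.booleanExpect φ
  expect_one := by
    have := Words.booleanExpect_word φ []
    simpa [Words.boolean] using this
  emb := Words.emb₀
  expect_emb j X := by
    have := Words.booleanExpect_word φ [(j, X)]
    simpa [Words.boolean, Words.booleanAux] using this
  spread n X i h hh := by
    have e := fun i : Fin n → ℕ => ofFn_emb (fun j a => Words.emb₀ (A := A) j a) i X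
    refine (congrArg _ (e i)).trans (Eq.trans ?_ (congrArg _ (e fun k => h (i k))).symm)
    rw [ofFn_relabel, Words.booleanExpect_word, Words.booleanExpect_word,
      Words.boolean_map φ h _ hh _ (ofFn_mem_range i X)]

/-- The monotone spreadability system. -/
noncomputable def monotoneSystem : SpreadabilitySystem φ where
  U := Words.FreeProd₀ A
  expect := Words.monotoneExpect φ
  expect_one := by
    have := Words.monotoneExpect_word φ []
    simpa [Words.monotoneAux] using this
  emb := Words.emb₀
  expect_emb j X := by
    have := Words.monotoneExpect_word φ [(j, X)]
    simpa [Words.monotoneAux_nil_cons, Words.monotoneAux] using this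
  spread n X i h hh := by
    have e := fun i : Fin n → ℕ => ofFn_emb (fun j a => Words.emb₀ (A := A) j a) i X
    refine (congrArg _ (e i)).trans (Eq.trans ?_ (congrArg _ (e fun k => h (i k))).symm)
    rw [ofFn_relabel, Words.monotoneExpect_word, Words.monotoneExpect_word]
    exact (Words.monotoneAux_map φ h _ hh _ (ofFn_mem_range i X) [] (by simp)).symm

end Systems

/-! Label every letter `X k` by the number `p` of its block. Since the entries of a multiindex lie
below `N`, the lexicographic order of the pairs (block number, entry) is the order of the integers
`N * p + m`. So `φ_π(N.X₁, …, N.Xₙ)` is a sum of expectations over all words in which each label `p`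
is replaced by some `N * p + m` with `m < N` (`dotMoment_eq`). A polynomial over `B` is determined
by its values at the natural numbers, hence any polynomial with these values may be used to compute
the cumulant. For a single nonempty block this polynomial vanishes at `N = 0` and its linear
coefficient is `K_m`. So whenever the polynomial of `π` is the product of the polynomials of its
blocks, the coefficient of `N ^ |π|` is the product of the linear coefficients, which is `K_(π)`
(`cumulant_eq_mulCumulant`).

Tensor case: different blocks are relabelled to disjoint sets of copies, and the expectation factors
over the copies, so the polynomial always factors over the blocks.

Boolean and monotone cases: the letters of a word are put on a stack, and a run of letters is
removed, with its expectation as a factor, as soon as a letter arrives that can neither join it nor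
be put on top of it. The polynomial of `π` is therefore a product over runs, each of them part of a
block (`dotSum_eq_prod_runs`). If every block is one run, this is the product over the blocks.
Otherwise there are more than `|π|` factors, all divisible by `N`, and the coefficient of `N ^ |π|`
is zero (`cumulant_of_runs`). A block is broken into several runs exactly when `π` is not an
interval partition, respectively not monotone.

Free case: the expectation of a word is the sum, over the noncrossing partitions `ρ` finer than its
kernel, of the products of free cumulants (`freeAux_eq_ncSum`). In the sum over all relabellings
every block of `ρ` chooses one of `N` labels, so the polynomial of `π` is the sum of `N ^ |ρ| * ∏
k(X_P)` over the noncrossing `ρ` finer than `π` (`dotSum_ncSum`). Such a `ρ` has at least `|π|`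
blocks, with equality only if it has the same blocks as `π`, which requires `π` to be noncrossing
(`coeff_ncSum`). The case of one block identifies the free cumulants with `K_m`. -/

/-! ### Sums over relabelled words -/

namespace Words

section DotSum

variable {A : Type*} {B : Type*} [CommRing B]

/-- The sum of `f` over all words obtained from `w` by replacing every letter `(p, a)` by a letter
`(N * p + m, a)` with `m < N`. -/
def dotSum (N : ℕ) : List (ℕ × A) → (List (ℕ × A) → B) → B
  | [], f => f []
  | (p, a) :: w, f => ∑ m ∈ Finset.range N, dotSum N w fun v => f ((N * p + m, a) :: v)

/-- Division of the labels by `N` undoes the relabelling, so only the words lying over `w` matter.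
-/
theorem dotSum_congr (N : ℕ) (w : List (ℕ × A)) : ∀ f g : List (ℕ × A) → B,
    (∀ v, (v.map fun x => (x.1 / N, x.2)) = w → f v = g v) → dotSum N w f = dotSum N w g := by
  induction w with
  | nil => intro f g h; exact h [] rfl
  | cons x w ih =>
    intro f g h
    refine Finset.sum_congr rfl fun m hm => ih _ _ fun v hv => h _ ?_
    have hm' := Finset.mem_range.1 hm
    rw [List.map_cons, hv, Nat.mul_add_div (by omega), Nat.div_eq_of_lt hm', add_zero]

theorem dotSum_append (N : ℕ) (u w : List (ℕ × A)) : ∀ f : List (ℕ × A) → B,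
    dotSum N (u ++ w) f = dotSum N u fun u' => dotSum N w fun w' => f (u' ++ w') := by
  induction u with
  | nil => intro f; rfl
  | cons x u ih => intro f; exact Finset.sum_congr rfl fun m _ => ih _

theorem dotSum_mul_left (N : ℕ) (c : B) (w : List (ℕ × A)) : ∀ f : List (ℕ × A) → B,
    dotSum N w (fun v => c * f v) = c * dotSum N w f := by
  induction w with
  | nil => intro f; rfl
  | cons x w ih =>
    intro f
    simp only [dotSum, Finset.mul_sum]
    exact Finset.sum_congr rfl fun m _ => ih _

theorem dotSum_mul_right (N : ℕ) (c : B) (w : List (ℕ × A)) (f : List (ℕ × A) → B) :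
    dotSum N w (fun v => f v * c) = dotSum N w f * c := by
  simpa only [mul_comm] using dotSum_mul_left N c w f

theorem dotSum_zero {w : List (ℕ × A)} (hw : w ≠ []) (f : List (ℕ × A) → B) :
    dotSum 0 w f = 0 := by
  cases w with
  | nil => exact absurd rfl hw
  | cons x w => exact Finset.sum_range_zero _

theorem dotSum_map_add (N p : ℕ) (w : List (ℕ × A)) : ∀ f : List (ℕ × A) → B,
    dotSum N (w.map fun x => (p + x.1, x.2)) f
      = dotSum N w fun v => f (v.map fun x => (N * p + x.1, x.2)) := by
  induction w with
  | nil => intro f; rfl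
  | cons x w ih =>
    intro f
    refine Finset.sum_congr rfl fun m _ => (ih _).trans ?_
    simp only [List.map_cons, mul_add, add_assoc]

theorem dotSum_ofFn (N : ℕ) : ∀ {n : ℕ} (p : Fin n → ℕ) (X : Fin n → A) (f : List (ℕ × A) → B),
    dotSum N (List.ofFn fun k => (p k, X k)) f
      = ∑ i : Fin n → Fin N, f (List.ofFn fun k => (N * p k + i k, X k)) := by
  intro n
  induction n with
  | zero => intro p X f; simp [dotSum]
  | succ n ih =>
    intro p X f
    rw [List.ofFn_succ, dotSum, Finset.sum_range,
      ← (Fin.consEquiv fun _ : Fin (n + 1) => Fin N).sum_comp, Fintype.sum_prod_type]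
    refine Finset.sum_congr rfl fun m _ => ?_
    rw [ih (fun k => p k.succ) fun k => X k.succ]
    refine Finset.sum_congr rfl fun i _ => ?_
    rw [List.ofFn_succ]
    simp

/-- The letters of a word that have the given label. -/
def sub (w : List (ℕ × A)) (a : ℕ) : List A :=
  (w.filter fun x => x.1 = a).map fun x => x.2

@[simp] theorem sub_nil (a : ℕ) : sub ([] : List (ℕ × A)) a = [] := rfl

theorem sub_cons (x : ℕ × A) (w : List (ℕ × A)) (a : ℕ) :
    sub (x :: w) a = if x.1 = a then x.2 :: sub w a else sub w a := by
  by_cases h : x.1 = a <;> simp [sub, h]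

theorem sub_ne_nil {w : List (ℕ × A)} {a : ℕ} : sub w a ≠ [] ↔ a ∈ w.map Prod.fst := by
  simp [sub, List.filter_eq_nil_iff]

end DotSum

end Words

/-! ### Polynomials -/

/-- `B` may have zero divisors, so counting roots is not available over `B` itself. Linear
functionals `B → ℂ` separate points, and applied to the coefficients they reduce the claim to
polynomials over `ℂ`. -/
theorem Polynomial.eq_of_eval_natCast_eq {B : Type*} [CommRing B] [Algebra ℂ B]
    {p q : Polynomial B} (h : ∀ N : ℕ, p.eval (N : B) = q.eval (N : B)) : p = q := by
  rw [← sub_eq_zero]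
  ext k
  rw [Polynomial.coeff_zero, ← Module.forall_dual_apply_eq_zero_iff ℂ]
  intro f
  set r := p - q with hr
  have hr0 : ∀ N : ℕ, r.eval (N : B) = 0 := fun N => by rw [hr, Polynomial.eval_sub, h, sub_self]
  have key : (∑ k ∈ Finset.range (r.natDegree + 1), Polynomial.monomial k (f (r.coeff k)))
      = (0 : Polynomial ℂ) := by
    refine Polynomial.eq_zero_of_infinite_isRoot _ (Set.Infinite.mono ?_
      (Set.infinite_range_of_injective (Nat.cast_injective (R := ℂ))))
    rintro _ ⟨N, rfl⟩
    have := congrArg f (hr0 N)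
    rw [Polynomial.eval_eq_sum_range, map_sum, map_zero] at this
    change Polynomial.eval _ _ = 0
    rw [Polynomial.eval_finsetSum, ← this]
    refine Finset.sum_congr rfl fun k _ => ?_
    rw [Polynomial.eval_monomial]
    have e : r.coeff k * (N : B) ^ k = ((N : ℂ) ^ k) • r.coeff k := by
      rw [Algebra.smul_def, map_pow, map_natCast, mul_comm]
    rw [e, map_smul, smul_eq_mul, mul_comm]
  by_cases hk : k ≤ r.natDegree
  · have := congrArg (fun s => Polynomial.coeff s k) key
    simpa [Polynomial.finsetSum_coeff, Polynomial.coeff_monomial, Nat.lt_succ_iff, hk] using this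
  · rw [Polynomial.coeff_eq_zero_of_natDegree_lt (by omega), map_zero]

/-- One factor `X` can be taken out of every `p i`; what remains is evaluated at `0`. -/
theorem Polynomial.coeff_card_prod {B ι : Type*} [CommRing B] (s : Finset ι)
    (p : ι → Polynomial B) (hp : ∀ i ∈ s, Polynomial.X ∣ p i) :
    (∏ i ∈ s, p i).coeff s.card = ∏ i ∈ s, (p i).coeff 1 := by
  classical
  have h : ∀ i, ∃ q, i ∈ s → p i = Polynomial.X * q := fun i => by
    by_cases hi : i ∈ s
    · obtain ⟨q, hq⟩ := hp i hi; exact ⟨q, fun _ => hq⟩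
    · exact ⟨0, fun h => absurd h hi⟩
  choose q hq using h
  rw [Finset.prod_congr rfl fun i hi => hq i hi, Finset.prod_mul_distrib, Finset.prod_const,
    Polynomial.coeff_X_pow_mul', if_pos le_rfl, Nat.sub_self, Polynomial.coeff_zero_eq_eval_zero,
    Polynomial.eval_prod]
  refine Finset.prod_congr rfl fun i hi => ?_
  rw [hq i hi, Polynomial.coeff_X_mul, Polynomial.coeff_zero_eq_eval_zero]

/-! ### Cumulants and words -/

namespace OrderedSetPartition

variable {n : ℕ}

theorem kernel_idx_lt {α : Type*} [LinearOrder α] (i : Fin n → α) (k l : Fin n) :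
    (kernel i).idx k < (kernel i).idx l ↔ i k < i l := by
  exact ((Finset.univ.image i).orderIsoOfFin rfl).symm.lt_iff_lt

/-- The word with letters `X k`, labelled by the blocks. -/
def word {A : Type*} (π : OrderedSetPartition n) (X : Fin n → A) : List (ℕ × A) :=
  List.ofFn fun k => ((π.idx k : ℕ), X k)

theorem mem_word {A : Type*} (π : OrderedSetPartition n) (X : Fin n → A) (a : ℕ) :
    a ∈ (π.word X).map Prod.fst ↔ a < π.size := by
  simp only [word, List.map_ofFn, List.mem_ofFn', Set.mem_range, Function.comp_apply]
  constructor
  · rintro ⟨k, rfl⟩; exact (π.idx k).2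
  · intro h; obtain ⟨k, hk⟩ := π.surj ⟨a, h⟩; exact ⟨k, by rw [hk]⟩

theorem ofFn_orderEmbOfFin (s : Finset (Fin n)) :
    List.ofFn (s.orderEmbOfFin rfl) = (List.finRange n).filter (· ∈ s) := by
  have h1 : (List.ofFn (s.orderEmbOfFin rfl)).SortedLT := by
    rw [List.sortedLT_ofFn_iff]
    exact (s.orderEmbOfFin rfl).strictMono
  have h2 : ((List.finRange n).filter (· ∈ s)).SortedLT := by
    have := (List.sortedLT_finRange n).pairwise.filter (fun x => decide (x ∈ s))
    exact this.sortedLT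
  refine h1.eq_of_mem_iff h2 fun a => ?_
  rw [List.mem_ofFn', Finset.range_orderEmbOfFin]
  simp

theorem ofFn_block {A : Type*} (π : OrderedSetPartition n) (X : Fin n → A) (a : Fin π.size) :
    (List.ofFn fun k => X ((π.block a).orderEmbOfFin rfl k)) = Words.sub (π.word X) a := by
  have h : (List.ofFn fun k => X ((π.block a).orderEmbOfFin rfl k))
      = (List.ofFn ((π.block a).orderEmbOfFin rfl)).map X := by rw [List.map_ofFn]; rfl
  rw [h, ofFn_orderEmbOfFin, word, Words.sub, List.ofFn_eq_map, List.filter_map, List.map_map]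
  have : (List.finRange n).filter (· ∈ π.block a) = (List.finRange n).filter
      ((fun x : ℕ × A => decide (x.1 = a)) ∘ fun k => ((π.idx k : ℕ), X k)) := by
    refine List.filter_congr fun k _ => ?_
    simp [block, Fin.ext_iff]
  rw [this]
  rfl

theorem word_maximal {A : Type*} (X : Fin n → A) :
    (maximal n).word X = (List.ofFn X).map fun a => (0, a) := by
  rw [word, List.map_ofFn]
  congr 1
  funext k
  -- An inequality, because there is no block if `n = 0`.
  have h : (maximal n).size ≤ 1 := by
    change (Finset.univ.image fun _ : Fin n => (0 : ℕ)).card ≤ 1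
    refine (Finset.card_le_card (t := {0}) ?_).trans (Finset.card_singleton _).le
    simp [Finset.subset_iff]
  have := ((maximal n).idx k).2
  simp only [Function.comp_apply, Prod.mk.injEq, and_true]
  omega

theorem size_maximal (hn : 0 < n) : (maximal n).size = 1 := by
  have : Nonempty (Fin n) := ⟨⟨0, hn⟩⟩
  change (Finset.univ.image fun _ : Fin n => (0 : ℕ)).card = 1
  rw [Finset.image_const Finset.univ_nonempty, Finset.card_singleton]

end OrderedSetPartition

namespace SpreadabilitySystem

open OrderedSetPartition

variable {A : Type u} {B : Type v} [Ring A] [Algebra ℂ A] [CommRing B] [Algebra ℂ B]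
  {φ : A →ₗ[ℂ] B} (S : SpreadabilitySystem φ) {n : ℕ}

/-- The expectation of a word. -/
noncomputable def wordExpect (w : List (ℕ × A)) : B :=
  S.expect (w.map fun x => S.emb x.1 x.2).prod

theorem wordExpect_ofFn (i : Fin n → ℕ) (X : Fin n → A) :
    S.wordExpect (List.ofFn fun k => (i k, X k))
      = S.expect (List.ofFn fun k => S.emb (i k) (X k)).prod := by
  rw [wordExpect, List.map_ofFn]
  rfl

/-- The relabelling needed for `spread` is `i k ↦ j k`: it is well defined because the order
relations also determine the equalities. -/
theorem wordExpect_eq_of_lt_iff (i j : Fin n → ℕ) (h : ∀ k l, i k < i l ↔ j k < j l)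
    (X : Fin n → A) : S.wordExpect (List.ofFn fun k => (i k, X k))
      = S.wordExpect (List.ofFn fun k => (j k, X k)) := by
  classical
  have hinj : ∀ k l, i k = i l → j k = j l := fun k l hkl => by
    have h1 := h k l
    have h2 := h l k
    omega
  let g : ℕ → ℕ := fun m => if hm : ∃ k, i k = m then j hm.choose else 0
  have hg : ∀ k, g (i k) = j k := fun k => by
    have hk : ∃ l, i l = i k := ⟨k, rfl⟩
    simp only [g, dif_pos hk]
    exact hinj _ _ hk.choose_spec
  rw [wordExpect_ofFn, wordExpect_ofFn, S.spread n X i g]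
  · simp only [hg]
  · rintro _ ⟨k, rfl⟩ _ ⟨l, rfl⟩ hkl
    rw [hg, hg]
    exact (h k l).1 hkl

theorem wordExpect_map {h : ℕ → ℕ} (hh : StrictMono h) (w : List (ℕ × A)) :
    S.wordExpect (w.map fun x => (h x.1, x.2)) = S.wordExpect w := by
  have e : w = List.ofFn fun k => ((w.get k).1, (w.get k).2) := (List.ofFn_get w).symm
  rw [e, List.map_ofFn]
  exact S.wordExpect_eq_of_lt_iff (fun k => h (w.get k).1) (fun k => (w.get k).1)
    (fun k l => hh.lt_iff_lt) fun k => (w.get k).2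

/-- The quasi-meet orders its blocks lexicographically, and for entries below `N` the map `(p, m) ↦
N * p + m` is an order embedding of the lexicographic order into `ℕ`. -/
theorem dotMoment_eq (π : OrderedSetPartition n) (X : Fin n → A) (N : ℕ) :
    S.dotMoment π X N = Words.dotSum N (π.word X) S.wordExpect := by
  rw [word, Words.dotSum_ofFn, dotMoment]
  refine Finset.sum_congr rfl fun i _ => ?_
  rw [moment, ← wordExpect_ofFn]
  refine S.wordExpect_eq_of_lt_iff _ _ (fun k l => ?_) X
  rw [Fin.val_fin_lt, quasiMeet, kernel_idx_lt, Prod.Lex.toLex_lt_toLex, kernel_idx_lt]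
  have hk := (i k).2
  have hl := (i l).2
  have hN : 0 < N := by omega
  constructor
  · rintro (h | ⟨h, h'⟩)
    · have : N * ((π.idx k : ℕ) + 1) ≤ N * π.idx l := Nat.mul_le_mul_left _ h
      rw [mul_add] at this
      omega
    · change π.idx k = π.idx l at h
      rw [h]; exact Nat.add_lt_add_left h' _
  · intro h
    rcases lt_trichotomy (π.idx k) (π.idx l) with h1 | h1 | h1
    · exact Or.inl h1
    · rw [h1] at h
      exact Or.inr ⟨h1, Nat.lt_of_add_lt_add_left h⟩
    · have : N * ((π.idx l : ℕ) + 1) ≤ N * π.idx k := Nat.mul_le_mul_left _ h1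
      rw [mul_add] at this
      omega

/-- Frees the cumulant from the chosen `dotPolynomial`, by uniqueness of the interpolating
polynomial. -/
theorem cumulant_eq_coeff (π : OrderedSetPartition n) (X : Fin n → A) (p : Polynomial B)
    (hp : ∀ N : ℕ, p.eval (N : B) = Words.dotSum N (π.word X) S.wordExpect) :
    S.cumulant π X = p.coeff π.size := by
  rw [cumulant, Polynomial.eq_of_eval_natCast_eq (p := S.dotPolynomial π X) (q := p) fun N => ?_]
  rw [hp, ← dotMoment_eq]
  exact (S.exists_dotPolynomial π X).choose_spec N

theorem exists_listPolynomial (L : List A) : ∃ p : Polynomial B, ∀ N : ℕ,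
    p.eval (N : B) = Words.dotSum N (L.map fun a => (0, a)) S.wordExpect := by
  refine ⟨S.dotPolynomial (maximal L.length) L.get, fun N => ?_⟩
  refine ((S.exists_dotPolynomial (maximal L.length) L.get).choose_spec N).trans ?_
  rw [dotMoment_eq, word_maximal, List.ofFn_get]

/-- The polynomial with value `φ(N.X₁, …, N.Xₘ)` at `N`, for the list `[X₁, …, Xₘ]`. -/
noncomputable def listPolynomial (L : List A) : Polynomial B :=
  (S.exists_listPolynomial L).choose

theorem eval_listPolynomial (L : List A) (N : ℕ) : (S.listPolynomial L).eval (N : B)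
    = Words.dotSum N (L.map fun a => (0, a)) S.wordExpect :=
  (S.exists_listPolynomial L).choose_spec N

/-- By spreadability the number of a block is irrelevant when the block stands alone: it only shifts
all labels by `N * p`. -/
theorem eval_listPolynomial' (L : List A) (N p : ℕ) : (S.listPolynomial L).eval (N : B)
    = Words.dotSum N (L.map fun a => (p, a)) S.wordExpect := by
  rw [eval_listPolynomial]
  have h := Words.dotSum_map_add N p (L.map fun a => (0, a)) S.wordExpect
  rw [List.map_map] at h
  refine Eq.trans ?_ h.symm
  congr 1
  funext v
  exact (S.wordExpect_map (fun a b h => Nat.add_lt_add_left h _) v).symm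

/-- For `N = 0` a nonempty word has no relabelling, so the sum is empty. -/
theorem X_dvd_listPolynomial {L : List A} (hL : L ≠ []) : Polynomial.X ∣ S.listPolynomial L := by
  rw [Polynomial.X_dvd_iff, Polynomial.coeff_zero_eq_eval_zero]
  have := S.eval_listPolynomial L 0
  rwa [Nat.cast_zero, Words.dotSum_zero (by simpa using hL)] at this

theorem mulCumulant_eq (π : OrderedSetPartition n) (X : Fin n → A) :
    S.mulCumulant π X
      = ∏ a ∈ Finset.range π.size, (S.listPolynomial (Words.sub (π.word X) a)).coeff 1 := by
  rw [mulCumulant, Finset.prod_range]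
  refine Finset.prod_congr rfl fun a _ => ?_
  have hpos : 0 < (π.block a).card := by
    obtain ⟨k, hk⟩ := π.surj a
    exact Finset.card_pos.2 ⟨k, by simp [block, hk]⟩
  rw [← ofFn_block, S.cumulant_eq_coeff _ _ _ fun N => ?_, size_maximal hpos]
  rw [eval_listPolynomial, word_maximal]

/-- If `φ_π(N.X₁, …, N.Xₙ)` is the product over the blocks, then the cumulant is multiplicative. -/
theorem cumulant_eq_mulCumulant (π : OrderedSetPartition n) (X : Fin n → A)
    (h : ∀ N : ℕ, Words.dotSum N (π.word X) S.wordExpect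
      = ∏ a ∈ Finset.range π.size, (S.listPolynomial (Words.sub (π.word X) a)).eval (N : B)) :
    S.cumulant π X = S.mulCumulant π X := by
  rw [S.cumulant_eq_coeff π X (∏ a ∈ Finset.range π.size,
    S.listPolynomial (Words.sub (π.word X) a)) fun N => by rw [Polynomial.eval_prod, h],
    mulCumulant_eq]
  have := Polynomial.coeff_card_prod (Finset.range π.size)
    (fun a => S.listPolynomial (Words.sub (π.word X) a)) fun a ha =>
      S.X_dvd_listPolynomial (Words.sub_ne_nil.2 ((π.mem_word X a).2 (Finset.mem_range.1 ha)))
  rwa [Finset.card_range] at this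

end SpreadabilitySystem

/-! ### Systems in which blocks are removed run by run -/

namespace Words

/-! ### Labels that return after having been covered -/

section Returns

/-- A list without equal neighbours can use only one of two adjacent copies of `i`. -/
theorem sublist_of_sublist_cons_cons {α : Type*} {i : α} {u w l : List α}
    (hl : l.IsChain (· ≠ ·)) (h : l.Sublist (u ++ i :: i :: w)) : l.Sublist (u ++ i :: w) := by
  obtain ⟨l₁, l₂, rfl, h₁, h₂⟩ := List.sublist_append_iff.1 h
  refine h₁.append ?_
  have hl₂ := hl.right_of_append
  rcases List.sublist_cons_iff.1 h₂ with h₂ | ⟨r, rfl, h₃⟩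
  · exact h₂
  · refine List.Sublist.cons_cons i ?_
    rcases List.sublist_cons_iff.1 h₃ with h₃ | ⟨r', rfl, -⟩
    · exact h₃
    · exact absurd rfl (List.isChain_cons_cons.1 hl₂).1

theorem sublist_ofFn {α : Type*} {n : ℕ} (f : Fin n → α) (l : List α) :
    l.Sublist (List.ofFn f) ↔ ∃ js : List (Fin n), js.Pairwise (· < ·) ∧ l = js.map f := by
  rw [List.ofFn_eq_map, List.sublist_map_iff]
  refine exists_congr fun js => and_congr_left fun _ => ⟨fun h => ?_, fun h => ?_⟩
  · exact (List.sortedLT_finRange n).pairwise.sublist h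
  · exact List.sublist_of_subperm_of_sortedLE
      (List.subperm_of_subset (h.imp fun h => h.ne) fun _ _ => List.mem_finRange _)
      h.sortedLT.sortedLE (List.sortedLT_finRange n).sortedLE

variable (R : ℕ → ℕ → Prop)

/-- Some label returns after another label that may not be put on top of it. -/
def HasReturn (l : List ℕ) : Prop :=
  ∃ a b, a ≠ b ∧ ¬ R a b ∧ [a, b, a].Sublist l

theorem hasReturn_append_cons_cons (i : ℕ) (u w : List ℕ) :
    HasReturn R (u ++ i :: i :: w) ↔ HasReturn R (u ++ i :: w) := by
  refine ⟨fun ⟨a, b, hab, hR, h⟩ => ⟨a, b, hab, hR, ?_⟩,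
    fun ⟨a, b, hab, hR, h⟩ => ⟨a, b, hab, hR, ?_⟩⟩
  · exact sublist_of_sublist_cons_cons (by simp [hab, hab.symm]) h
  · exact h.trans ((List.Sublist.refl u).append (List.sublist_cons_self _ _))

/-- This is the moment when `i` is removed from the top of the stack `u, i` because of `j`. If `i`
occurs again, then `i, j, i` is a return. If not, `i` occurs only once: it cannot be the label that
returns, and it cannot be the label in between, since every label before it may have `i` on top. -/
theorem hasReturn_append_cons (i j : ℕ) (u w : List ℕ) (hu : ∀ a ∈ u, R a i) (hi : i ∉ u)
    (hij : i ≠ j) (hR : ¬ R i j) :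
    HasReturn R (u ++ i :: j :: w) ↔ i ∈ w ∨ HasReturn R (u ++ j :: w) := by
  constructor
  · rintro ⟨a, b, hab, hRab, h⟩
    by_cases hiw : i ∈ w
    · exact Or.inl hiw
    refine Or.inr ⟨a, b, hab, hRab, ?_⟩
    -- Deleting the only `i` leaves the pattern `a, b, a` intact once `a ≠ i` and `b ≠ i` are known.
    have hf := h.filter (fun x => decide (x ≠ i))
    have hi' : (u ++ i :: j :: w).filter (fun x => decide (x ≠ i)) = u ++ j :: w := by
      have h1 : u.filter (fun x => decide (x ≠ i)) = u :=
        List.filter_eq_self.2 fun x hx => by simpa using ne_of_mem_of_not_mem hx hi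
      have h2 : w.filter (fun x => decide (x ≠ i)) = w :=
        List.filter_eq_self.2 fun x hx => by simpa using ne_of_mem_of_not_mem hx hiw
      rw [List.filter_append, h1, List.filter_cons_of_neg (by simp),
        List.filter_cons_of_pos (by simpa using hij.symm), h2]
    rw [hi'] at hf
    have hc := h.count_le i
    have hc' : (u ++ i :: j :: w).count i = 1 := by
      simp [List.count_append, List.count_eq_zero_of_not_mem hi,
        List.count_eq_zero_of_not_mem hiw, hij.symm]
    have hai : a ≠ i := by
      rintro rfl
      rw [hc'] at hc
      simp [hab.symm] at hc
    -- If `b = i`, then the first `a` lies in `u`, so that `R a b` holds.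
    have hbi : b ≠ i := by
      rintro rfl
      obtain ⟨l₁, l₂, hl, h₁, h₂⟩ := List.sublist_append_iff.1 h
      cases l₁ with
      | nil =>
        rw [List.nil_append] at hl
        subst hl
        rcases List.sublist_cons_iff.1 h₂ with h₂ | ⟨r, hr, -⟩
        · have := h₂.subset (show b ∈ [a, b, a] by simp)
          simp [hij, hiw] at this
        · simp [hai] at hr
      | cons x l₁ =>
        have hx : a = x := by simpa using congrArg List.head? hl
        subst hx
        exact hRab (hu a (h₁.subset (by simp)))
    simpa [hai, hbi] using hf
  · rintro (h | ⟨a, b, hab, hRab, h⟩)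
    · refine ⟨i, j, hij, hR, List.Sublist.trans ?_ (List.sublist_append_right u _)⟩
      simpa using h
    · exact ⟨a, b, hab, hRab, h.trans ((List.Sublist.refl u).append (List.sublist_cons_self _ _))⟩

end Returns

/-! ### Decomposition of a word into runs -/

section Runs

variable {A : Type*} {B : Type*} [CommRing B] (R : ℕ → ℕ → Prop)

/-- The word spelled by a stack. -/
def flat : List (ℕ × List A) → List (ℕ × A)
  | [] => []
  | (i, L) :: s => flat s ++ L.map fun a => (i, a)

theorem mem_flat (s : List (ℕ × List A)) : ∀ x ∈ flat s, x.1 ∈ s.map Prod.fst := by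
  induction s with
  | nil => simp [flat]
  | cons y s ih =>
    intro x hx
    simp only [flat, List.mem_append, List.mem_map] at hx
    rcases hx with hx | ⟨a, _, rfl⟩
    · exact List.mem_cons_of_mem _ (ih x hx)
    · simp

/-- The concatenation of the lists with a given label. -/
def cat (s : List (ℕ × List A)) (a : ℕ) : List A :=
  (s.filter fun x => x.1 = a).flatMap Prod.snd

theorem cat_cons (x : ℕ × List A) (s : List (ℕ × List A)) (a : ℕ) :
    cat (x :: s) a = if x.1 = a then x.2 ++ cat s a else cat s a := by
  by_cases h : x.1 = a <;> simp [cat, h]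

theorem cat_eq_nil {s : List (ℕ × List A)} {a : ℕ} (h : a ∉ s.map Prod.fst) : cat s a = [] := by
  have : s.filter (fun x => x.1 = a) = [] := by
    rw [List.filter_eq_nil_iff]
    intro x hx hxa
    exact h (List.mem_map.2 ⟨x, hx, by simpa using hxa⟩)
  rw [cat, this, List.flatMap_nil]

theorem cat_of_nodup (s : List (ℕ × List A)) (h : (s.map Prod.fst).Nodup) :
    ∀ x ∈ s, cat s x.1 = x.2 := by
  induction s with
  | nil => simp
  | cons y s ih =>
    rw [List.map_cons, List.nodup_cons] at h
    intro x hx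
    rw [cat_cons]
    rcases List.mem_cons.1 hx with rfl | hx
    · rw [if_pos rfl, cat_eq_nil h.1, List.append_nil]
    · rw [if_neg fun e : y.1 = x.1 => h.1 (e ▸ List.mem_map_of_mem hx), ih h.2 x hx]

/-- The labels of a stack increase from the bottom to the top. -/
def Ordered (s : List (ℕ × List A)) : Prop :=
  s.Pairwise fun x y => R y.1 x.1

variable {R}

theorem Ordered.not_mem [Std.Irrefl R] {x : ℕ × List A} {s : List (ℕ × List A)}
    (h : Ordered R (x :: s)) : x.1 ∉ s.map Prod.fst := by
  intro hx
  obtain ⟨y, hy, e⟩ := List.mem_map.1 hx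
  have := (List.pairwise_cons.1 h).1 y hy
  rw [e] at this
  exact irrefl _ this

theorem Ordered.change {i : ℕ} {L : List A} {s : List (ℕ × List A)}
    (h : Ordered R ((i, L) :: s)) (L' : List A) : Ordered R ((i, L') :: s) :=
  List.pairwise_cons.2 ⟨(List.pairwise_cons.1 h).1, (List.pairwise_cons.1 h).2⟩

theorem Ordered.tail {x : ℕ × List A} {s : List (ℕ × List A)} (h : Ordered R (x :: s)) :
    Ordered R s := (List.pairwise_cons.1 h).2

theorem Ordered.push [IsTrans ℕ R] {j : ℕ} {L : List A} {y : ℕ × List A} {s : List (ℕ × List A)}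
    (h : Ordered R (y :: s)) (hj : R y.1 j) : Ordered R ((j, L) :: y :: s) := by
  refine List.pairwise_cons.2 ⟨fun z hz => ?_, h⟩
  rcases List.mem_cons.1 hz with rfl | hz
  · exact hj
  · exact _root_.trans ((List.pairwise_cons.1 h).1 z hz) hj

variable (R)

/-- The hypothesis on `E` sees only the quotients of the labels by `N`, that is, the labels before
relabelling. It therefore applies to all relabelled words simultaneously, and the relabellings of
`L` and of the rest are independent. -/
theorem dotSum_append_append (N : ℕ) (E : List (ℕ × A) → B)
    (hE : ∀ (i : ℕ) (u L v : List (ℕ × A)), (∀ x ∈ u, R (x.1 / N) i) → (∀ x ∈ L, x.1 / N = i) →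
      (∀ x ∈ v.head?, x.1 / N ≠ i ∧ ¬ R i (x.1 / N)) → E (u ++ L ++ v) = E L * E (u ++ v))
    (i : ℕ) (u v : List (ℕ × A)) (L : List A) (hu : ∀ x ∈ u, R x.1 i)
    (hv : ∀ x ∈ v.head?, x.1 ≠ i ∧ ¬ R i x.1) :
    dotSum N (u ++ L.map (fun a => (i, a)) ++ v) E
      = dotSum N (L.map fun a => (i, a)) E * dotSum N (u ++ v) E := by
  rw [dotSum_append, dotSum_append, dotSum_append, ← dotSum_mul_left]
  refine dotSum_congr N u _ _ fun u' hu' => ?_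
  rw [← dotSum_mul_right]
  refine dotSum_congr N _ _ _ fun L' hL' => ?_
  rw [← dotSum_mul_left]
  refine dotSum_congr N _ _ _ fun v' hv' => hE i u' L' v' (fun x hx => ?_) (fun x hx => ?_)
    fun x hx => ?_
  · exact hu (x.1 / N, x.2) (hu' ▸ List.mem_map_of_mem hx)
  · have : (x.1 / N, x.2) ∈ L.map fun a => (i, a) :=
      hL' ▸ List.mem_map_of_mem (f := fun x : ℕ × A => (x.1 / N, x.2)) hx
    obtain ⟨a, -, h⟩ := List.mem_map.1 this
    exact (congrArg Prod.fst h).symm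
  · refine hv (x.1 / N, x.2) ?_
    rw [← hv', List.head?_map, Option.mem_def.1 hx]
    rfl

variable [DecidableRel R]

/-- The decomposition of the word spelled by the stack `s` followed by `w` into the runs that are
removed one after the other: a letter is put on top of the stack, joins the run on top of the
stack, or the run on top of the stack is removed first. -/
def runs : List (ℕ × List A) → List (ℕ × A) → List (ℕ × List A)
  | s, [] => s
  | [], (j, b) :: w => runs [(j, [b])] w
  | (i, L) :: s, (j, b) :: w =>
    if i = j then runs ((i, L ++ [b]) :: s) w
    else if R i j then runs ((j, [b]) :: (i, L) :: s) w
    else (i, L) :: runs s ((j, b) :: w)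
  termination_by s w => 2 * w.length + s.length
  decreasing_by all_goals (simp only [List.length_cons, List.length_nil]; omega)

theorem runs_nil (s : List (ℕ × List A)) : runs R s [] = s := by rw [runs]

theorem runs_nil_cons (x : ℕ × A) (w : List (ℕ × A)) :
    runs R [] (x :: w) = runs R [(x.1, [x.2])] w := by rw [runs]

theorem runs_cons_cons (y : ℕ × List A) (x : ℕ × A) (s : List (ℕ × List A)) (w : List (ℕ × A)) :
    runs R (y :: s) (x :: w) =
      if y.1 = x.1 then runs R ((y.1, y.2 ++ [x.2]) :: s) w
      else if R y.1 x.1 then runs R ((x.1, [x.2]) :: y :: s) w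
      else y :: runs R s (x :: w) := by rw [runs]

theorem mem_runs (w : List (ℕ × A)) : ∀ (s : List (ℕ × List A)) (a : ℕ),
    a ∈ (runs R s w).map Prod.fst ↔ a ∈ s.map Prod.fst ∨ a ∈ w.map Prod.fst := by
  induction w with
  | nil => intro s a; simp [runs_nil]
  | cons x w ih =>
    intro s a
    induction s with
    | nil => rw [runs_nil_cons, ih]; simp
    | cons y s ihs =>
      rw [runs_cons_cons]
      split_ifs with h1 h2
      · rw [ih]; simp only [List.map_cons, List.mem_cons, h1]; tauto
      · rw [ih]; simp only [List.map_cons, List.mem_cons]; tauto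
      · rw [List.map_cons, List.mem_cons, ihs]; simp only [List.map_cons, List.mem_cons]; tauto

theorem runs_ne_nil (w : List (ℕ × A)) : ∀ s : List (ℕ × List A), (∀ x ∈ s, x.2 ≠ []) →
    ∀ x ∈ runs R s w, x.2 ≠ [] := by
  induction w with
  | nil => intro s hs; rwa [runs_nil]
  | cons x w ih =>
    intro s hs
    induction s with
    | nil => rw [runs_nil_cons]; exact ih _ (by simp)
    | cons y s ihs =>
      have hs' := List.forall_mem_cons.1 hs
      rw [runs_cons_cons]
      split_ifs with h1 h2
      · exact ih _ (List.forall_mem_cons.2 ⟨by simp, hs'.2⟩)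
      · exact ih _ (List.forall_mem_cons.2 ⟨by simp, hs⟩)
      · exact List.forall_mem_cons.2 ⟨hs'.1, ihs hs'.2⟩

/-- No letter is lost, and letters with the same label keep their order: an ordered stack holds at
most one run of each label, and a removed run precedes all runs of its label that are formed later.
So if a block forms one run, that run is `X_P`. -/
theorem cat_runs [IsTrans ℕ R] [Std.Irrefl R] (w : List (ℕ × A)) (a : ℕ) : ∀ s : List (ℕ × List A), Ordered R s →
    cat (runs R s w) a = cat s a ++ sub w a := by
  induction w with
  | nil => intro s _; simp [runs_nil]
  | cons x w ih =>
    intro s hs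
    induction s with
    | nil =>
      rw [runs_nil_cons, ih _ (List.pairwise_singleton _ _), cat_cons, sub_cons]
      split_ifs <;> simp [cat]
    | cons y s ihs =>
      rw [runs_cons_cons]
      split_ifs with h1 h2
      · rw [ih _ (hs.change _), cat_cons, cat_cons, sub_cons]
        by_cases ha : y.1 = a
        · rw [if_pos ha, if_pos ha, if_pos (h1 ▸ ha), cat_eq_nil (ha ▸ hs.not_mem)]
          simp
        · rw [if_neg ha, if_neg ha, if_neg (h1 ▸ ha)]
      · have hs' := hs.push (L := [x.2]) h2
        rw [ih _ hs', cat_cons, sub_cons]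
        by_cases ha : x.1 = a
        · rw [if_pos ha, if_pos ha, cat_eq_nil (ha ▸ hs'.not_mem)]
          simp
        · rw [if_neg ha, if_neg ha]
      · rw [cat_cons, cat_cons, ihs hs.tail]
        by_cases ha : y.1 = a
        · rw [if_pos ha, if_pos ha, cat_eq_nil (ha ▸ hs.not_mem)]
          simp
        · rw [if_neg ha, if_neg ha]

/-- A label gives two runs exactly when it occurs again after its run has been removed, and a
removal is caused by a letter that may not be put on top. The stack is read from bottom to top as a
prefix of the remaining word. -/
theorem nodup_runs [IsTrans ℕ R] [Std.Irrefl R] (w : List (ℕ × A)) : ∀ s : List (ℕ × List A), Ordered R s →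
    (((runs R s w).map Prod.fst).Nodup ↔
      ¬ HasReturn R ((s.map Prod.fst).reverse ++ w.map Prod.fst)) := by
  induction w with
  | nil =>
    intro s hs
    have hn : (s.map Prod.fst).Nodup := by
      induction s with
      | nil => simp
      | cons y s ih => exact List.nodup_cons.2 ⟨hs.not_mem, ih hs.tail⟩
    simp only [runs_nil, List.map_nil, List.append_nil, hn, true_iff]
    rintro ⟨a, b, hab, -, h⟩
    have := (List.nodup_reverse.2 hn).sublist h
    simp at this
  | cons x w ih =>
    intro s hs
    induction s with
    | nil =>
      rw [runs_nil_cons, ih _ (List.pairwise_singleton _ _)]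
      simp
    | cons y s ihs =>
      rw [runs_cons_cons]
      split_ifs with h1 h2
      · rw [ih _ (hs.change _)]
        simp only [List.map_cons, List.reverse_cons, List.append_assoc, List.singleton_append, ← h1]
        rw [hasReturn_append_cons_cons]
      · rw [ih _ (hs.push h2)]
        simp
      · have hns := hs.not_mem
        rw [List.map_cons, List.nodup_cons, ihs hs.tail, mem_runs]
        simp only [List.map_cons, List.reverse_cons, List.append_assoc, List.singleton_append]
        rw [hasReturn_append_cons R y.1 x.1 _ _ (fun a ha => ?_) (by simpa using hns) h1 h2]
        · simp only [List.mem_cons, hns, h1]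
          tauto
        · obtain ⟨z, hz, rfl⟩ := List.mem_map.1 (List.mem_reverse.1 ha)
          exact (List.pairwise_cons.1 hs).1 z hz

/-- Every removal of a run splits off one factor by `dotSum_append_append`; the other two moves of
`runs` do not change the word spelled by the stack and the remaining letters. -/
theorem dotSum_eq_prod_runs [IsTrans ℕ R] (N : ℕ) (E : List (ℕ × A) → B) (hE₀ : E [] = 1)
    (hE : ∀ (i : ℕ) (u L v : List (ℕ × A)), (∀ x ∈ u, R (x.1 / N) i) → (∀ x ∈ L, x.1 / N = i) →
      (∀ x ∈ v.head?, x.1 / N ≠ i ∧ ¬ R i (x.1 / N)) → E (u ++ L ++ v) = E L * E (u ++ v))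
    (w : List (ℕ × A)) : ∀ s : List (ℕ × List A), Ordered R s →
    dotSum N (flat s ++ w) E
      = ((runs R s w).map fun x => dotSum N (x.2.map fun a => (x.1, a)) E).prod := by
  have hflat : ∀ (y : ℕ × List A) (s : List (ℕ × List A)), Ordered R (y :: s) →
      ∀ x ∈ flat s, R x.1 y.1 := fun y s hs x hx => by
    obtain ⟨z, hz, e⟩ := List.mem_map.1 (mem_flat s x hx)
    exact e ▸ (List.pairwise_cons.1 hs).1 z hz
  induction w with
  | nil =>
    intro s hs
    induction s with
    | nil => simpa [runs_nil, flat, dotSum] using hE₀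
    | cons y s ihs =>
      have := dotSum_append_append R N E hE y.1 (flat s) [] y.2 (hflat y s hs) (by simp)
      rw [runs_nil, List.map_cons, List.prod_cons, flat, this, ihs hs.tail, runs_nil]
  | cons x w ih =>
    intro s hs
    induction s with
    | nil =>
      rw [runs_nil_cons, ← ih _ (List.pairwise_singleton _ _)]
      rfl
    | cons y s ihs =>
      rw [runs_cons_cons]
      split_ifs with h1 h2
      · rw [← ih _ (hs.change _)]
        simp [flat, h1]
      · rw [← ih _ (hs.push h2)]
        simp [flat]
      · have := dotSum_append_append R N E hE y.1 (flat s) (x :: w) y.2 (hflat y s hs)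
          (by simpa using ⟨Ne.symm h1, h2⟩)
        rw [List.map_cons, List.prod_cons, flat, this, ihs hs.tail]

end Runs

end Words

/-! ### Cumulants from the decomposition into runs -/

namespace SpreadabilitySystem

open OrderedSetPartition Words

variable {A : Type u} {B : Type v} [Ring A] [Algebra ℂ A] [CommRing B] [Algebra ℂ B]
  {φ : A →ₗ[ℂ] B} (S : SpreadabilitySystem φ) {n : ℕ}

theorem X_pow_length_dvd (l : List (ℕ × List A)) (h : ∀ x ∈ l, x.2 ≠ []) :
    Polynomial.X ^ l.length ∣ (l.map fun x => S.listPolynomial x.2).prod := by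
  induction l with
  | nil => simp
  | cons x l ih =>
    have h' := List.forall_mem_cons.1 h
    rw [List.map_cons, List.prod_cons, List.length_cons, pow_succ']
    exact mul_dvd_mul (S.X_dvd_listPolynomial h'.1) (ih h'.2)

/-- The cumulants of a system in which the runs of a block are removed one after the other. -/
theorem cumulant_of_runs (R : ℕ → ℕ → Prop) [DecidableRel R] [IsTrans ℕ R] [Std.Irrefl R]
    (hE : ∀ (N i : ℕ) (u L v : List (ℕ × A)), (∀ x ∈ u, R (x.1 / N) i) → (∀ x ∈ L, x.1 / N = i) →
      (∀ x ∈ v.head?, x.1 / N ≠ i ∧ ¬ R i (x.1 / N)) →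
      S.wordExpect (u ++ L ++ v) = S.wordExpect L * S.wordExpect (u ++ v))
    (π : OrderedSetPartition n) (X : Fin n → A) :
    (¬ HasReturn R ((π.word X).map Prod.fst) → S.cumulant π X = S.mulCumulant π X) ∧
    (HasReturn R ((π.word X).map Prod.fst) → S.cumulant π X = 0) := by
  set w := π.word X with hw
  set l := runs R [] w with hl
  have hsum : ∀ N : ℕ, dotSum N w S.wordExpect
      = (l.map fun x => (S.listPolynomial x.2).eval (N : B)).prod := fun N => by
    have := dotSum_eq_prod_runs R N S.wordExpect (by simpa [wordExpect] using S.expect_one)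
      (hE N) w [] List.Pairwise.nil
    refine this.trans (congrArg List.prod (List.map_congr_left fun x _ => ?_))
    exact (S.eval_listPolynomial' x.2 N x.1).symm
  have hmem : (l.map Prod.fst).toFinset = Finset.range π.size := by
    ext a
    rw [List.mem_toFinset, mem_runs, Finset.mem_range, ← π.mem_word X]
    simp [hw]
  have hnodup : (l.map Prod.fst).Nodup ↔ ¬ HasReturn R (w.map Prod.fst) :=
    nodup_runs R w [] List.Pairwise.nil
  have hcat : ∀ a, cat l a = sub w a := fun a => by
    rw [hl, cat_runs R w a [] List.Pairwise.nil]
    rfl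
  constructor
  · intro h
    have hn := hnodup.2 h
    refine S.cumulant_eq_mulCumulant π X fun N => ?_
    rw [hsum, ← hmem, List.prod_toFinset _ hn, List.map_map]
    congr 1
    refine List.map_congr_left fun x hx => ?_
    rw [← cat_of_nodup l hn x hx, hcat]
    rfl
  · intro h
    have hn := fun hn => hnodup.1 hn h
    rw [S.cumulant_eq_coeff π X (l.map fun x => S.listPolynomial x.2).prod fun N => by
      rw [Polynomial.eval_list_prod, List.map_map, hsum]; rfl]
    -- The labels of the runs are exactly the `|π|` block numbers, and one of them is repeated.
    have hlen : π.size < l.length := by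
      have h1 : (l.map Prod.fst).toFinset.card = π.size := by rw [hmem, Finset.card_range]
      have h2 := (l.map Prod.fst).toFinset_card_le
      rw [List.length_map] at h2
      refine lt_of_le_of_ne (h1 ▸ h2) fun e => hn ?_
      rw [← Multiset.coe_nodup, ← Multiset.toFinset_card_eq_card_iff_nodup]
      simpa [← e] using h1
    -- Every run is nonempty and contributes a factor `X`, so the coefficient in question lies below
    -- the order of vanishing at `0`.
    refine Polynomial.X_pow_dvd_iff.1 ?_ _ hlen
    exact S.X_pow_length_dvd l (runs_ne_nil R w [] (by simp))

end SpreadabilitySystem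

/-! ### The Boolean and monotone systems -/

namespace OrderedSetPartition

variable {n : ℕ}

theorem map_fst_word {A : Type*} (π : OrderedSetPartition n) (X : Fin n → A) :
    (π.word X).map Prod.fst = List.ofFn fun k => (π.idx k : ℕ) := by
  rw [word, List.map_ofFn]
  rfl

theorem hasReturn_iff {A : Type*} (π : OrderedSetPartition n) (X : Fin n → A)
    (R : ℕ → ℕ → Prop) : Words.HasReturn R ((π.word X).map Prod.fst) ↔
      ∃ i j k, i < j ∧ j < k ∧ π.idx i = π.idx k ∧ π.idx i ≠ π.idx j
        ∧ ¬ R (π.idx i) (π.idx j) := by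
  simp only [Words.HasReturn, map_fst_word, Words.sublist_ofFn]
  constructor
  · rintro ⟨a, b, hab, hR, js, hjs, h⟩
    obtain ⟨i, j, k, rfl⟩ := List.length_eq_three.1 (show js.length = 3 by
      simpa using (congrArg List.length h).symm)
    simp only [List.map_cons, List.map_nil, List.cons.injEq, and_true] at h
    obtain ⟨rfl, rfl, h⟩ := h
    simp only [List.pairwise_cons, List.mem_cons] at hjs
    exact ⟨i, j, k, hjs.1 _ (Or.inl rfl), hjs.2.1 _ (Or.inl rfl), Fin.ext h,
      fun e => hab (congrArg _ e), hR⟩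
  · rintro ⟨i, j, k, hij, hjk, hik, hne, hR⟩
    refine ⟨π.idx i, π.idx j, fun e => hne (Fin.ext e), hR, [i, j, k], ?_, ?_⟩
    · simp [hij, hjk, hij.trans hjk]
    · simp [hik]

/-- When nothing may be put on top of anything, a return is just a foreign point between two points
of a block. -/
theorem isInterval_iff {A : Type*} (π : OrderedSetPartition n) (X : Fin n → A) :
    π.IsInterval ↔ ¬ Words.HasReturn (fun _ _ => False) ((π.word X).map Prod.fst) := by
  rw [hasReturn_iff, IsInterval]
  constructor
  · rintro h ⟨i, j, k, hij, hjk, hik, hne, -⟩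
    have := (h (π.idx i)).out (x := i) (by simp [block]) (y := k) (by simp [block, hik])
      ⟨hij.le, hjk.le⟩
    exact hne (by simpa [block, eq_comm] using this)
  · intro h a
    refine ⟨fun i hi k hk j hj => ?_⟩
    simp only [block, Finset.coe_filter, Finset.mem_univ, true_and] at hi hk ⊢
    change π.idx i = a at hi
    change π.idx k = a at hk
    change π.idx j = a
    by_contra hja
    have h1 : i ≠ j := by rintro rfl; exact hja hi
    have h2 : j ≠ k := by rintro rfl; exact hja hk
    exact h ⟨i, j, k, lt_of_le_of_ne hj.1 h1, lt_of_le_of_ne hj.2 h2, hi.trans hk.symm,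
      fun e => hja (e ▸ hi), not_false⟩

/-- A return for `<` is a point of a smaller label between two points of a larger one. Both a
crossing and a nesting in the wrong order produce one; conversely, if there are no crossings, a
return comes from a nesting in the wrong order. -/
theorem isMonotone_iff {A : Type*} (π : OrderedSetPartition n) (X : Fin n → A) :
    π.IsMonotone ↔ ¬ Words.HasReturn (· < ·) ((π.word X).map Prod.fst) := by
  rw [hasReturn_iff]
  simp only [Fin.val_fin_lt]
  constructor
  · rintro ⟨hnc, hm⟩ ⟨i, j, k, hij, hjk, hik, hne, hlt⟩
    -- Noncrossingness confines the whole block of `j` to the gap between `i` and `k`, so it is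
    -- nested in the block of `i`.
    refine hlt (hm _ _ ⟨i, by simp [block], k, by simp [block, hik], fun l hl => ?_⟩)
    have hlj : π.idx l = π.idx j := by simpa [block] using hl
    constructor
    · by_contra hli
      rcases lt_or_eq_of_le (not_lt.1 hli) with h | rfl
      · exact hne ((hnc l i j k h hij hjk hlj hik).symm.trans hlj)
      · exact hne hlj
    · by_contra hlk
      rcases lt_or_eq_of_le (not_lt.1 hlk) with h | rfl
      · exact hne (hnc i j k l hij hjk h hik hlj.symm)
      · exact hne (hik.trans hlj)
  · intro h
    refine ⟨fun i j k l hij hjk hkl hik hjl => ?_, fun a b hab => ?_⟩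
    · by_contra hne
      -- In a crossing each label encloses a point of the other one; the return is that of the
      -- larger label.
      rcases lt_or_gt_of_ne hne with hlt | hlt
      · exact h ⟨j, k, l, hjk, hkl, hjl, fun e => hne (hik.trans e.symm), by
          rw [← hik]; exact hlt.not_gt⟩
      · exact h ⟨i, j, k, hij, hjk, hik, hne, hlt.not_gt⟩
    · obtain ⟨i, hi, k, hk, hb⟩ := hab
      obtain ⟨j, hj⟩ := π.surj b
      have hi' : π.idx i = a := by simpa [block] using hi
      have hk' : π.idx k = a := by simpa [block] using hk
      have hj' := hb j (by simp [block, hj])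
      by_contra hlt
      refine h ⟨i, j, k, hj'.1, hj'.2, hi'.trans hk'.symm, ?_, by rwa [hi', hj]⟩
      rw [hi', hj]
      rintro rfl
      exact lt_irrefl _ (hb i hi).1

end OrderedSetPartition

/-! ### Factorisation of the Boolean and monotone expectations -/

namespace Words

variable {A : Type u} {B : Type v} [Ring A] [Algebra ℂ A] [CommRing B] [Algebra ℂ B]
  (φ : A →ₗ[ℂ] B)

/-- No letters are multiplied across the cut between `L` and `v`. -/
theorem boolean_append (L v : List (ℕ × A))
    (h : ∀ y ∈ L, ∀ x ∈ v.head?, x.1 ≠ y.1) :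
    boolean φ (L ++ v) = boolean φ L * boolean φ v := by
  cases v with
  | nil => simp [boolean]
  | cons x v =>
    have key : ∀ (L : List (ℕ × A)) (i : ℕ) (a : A), (∀ y ∈ L, x.1 ≠ y.1) → x.1 ≠ i →
        booleanAux φ i a (L ++ x :: v) = booleanAux φ i a L * booleanAux φ x.1 x.2 v := by
      intro L
      induction L with
      | nil => intro i a _ hi; simp [booleanAux, hi.symm]
      | cons y L ih =>
        intro i a hL hi
        have hL' := List.forall_mem_cons.1 hL
        simp only [List.cons_append, booleanAux]
        split_ifs with hy
        · rw [ih _ _ hL'.2 hi]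
        · rw [ih _ _ hL'.2 hL'.1, mul_assoc]
    have h' : ∀ y ∈ L, x.1 ≠ y.1 := fun y hy => h y hy x rfl
    cases L with
    | nil => simp [boolean]
    | cons y L =>
      have h'' := List.forall_mem_cons.1 h'
      exact key L y.1 y.2 h''.2 h''.1

/-- The letters of `L` lie above the whole stack `s`, so they are processed without touching it, and
they also lie above the first letter of `v`, which removes what is left of them. In the induction,
`s₁` is the part of the stack that stems from letters of `L` already read. -/
theorem monotoneAux_append (v : List (ℕ × A)) (s : List (ℕ × A)) (L : List (ℕ × A)) :
    ∀ s₁ : List (ℕ × A),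
    (∀ y ∈ s₁, (∀ x ∈ s, x.1 < y.1) ∧ ∀ x ∈ v.head?, x.1 < y.1) →
    (∀ y ∈ L, (∀ x ∈ s, x.1 < y.1) ∧ ∀ x ∈ v.head?, x.1 < y.1) →
    monotoneAux φ (s₁ ++ s) (L ++ v) = monotoneAux φ s₁ L * monotoneAux φ s v := by
  induction L with
  | nil =>
    intro s₁ hs₁ _
    cases v with
    | nil => simp [monotoneAux]
    | cons x v =>
      induction s₁ with
      | nil => simp [monotoneAux]
      | cons y s₁ ih =>
        have h := List.forall_mem_cons.1 hs₁
        have hxy : x.1 < y.1 := h.1.2 x rfl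
        have := ih h.2
        simp only [List.nil_append, monotoneAux, List.map_cons, List.prod_cons] at this ⊢
        rw [List.cons_append, monotoneAux_cons_cons, if_neg hxy.not_gt, if_neg hxy.ne', this,
          mul_assoc]
  | cons l L ihL =>
    intro s₁ hs₁ hL
    have hL' := List.forall_mem_cons.1 hL
    induction s₁ with
    | nil =>
      rw [List.nil_append, List.cons_append, monotoneAux_nil_cons,
        ← ihL [l] (by simpa using hL'.1) hL'.2]
      cases s with
      | nil => rw [monotoneAux_nil_cons]; rfl
      | cons z s =>
        rw [monotoneAux_cons_cons, if_pos (hL'.1.1 z (by simp))]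
        rfl
    | cons y s₁ ih =>
      have h := List.forall_mem_cons.1 hs₁
      have h1 := ihL (l :: y :: s₁) (List.forall_mem_cons.2 ⟨hL'.1, hs₁⟩) hL'.2
      have h2 := ihL ((y.1, y.2 * l.2) :: s₁) (List.forall_mem_cons.2 ⟨h.1, h.2⟩) hL'.2
      have h3 := ih h.2
      simp only [List.cons_append] at h1 h2 h3
      simp only [List.cons_append, monotoneAux_cons_cons, h1, h2, h3]
      split_ifs <;> ring

theorem monotoneAux_append_append (v : List (ℕ × A)) (L : List (ℕ × A)) (u : List (ℕ × A)) :
    ∀ s : List (ℕ × A), (∀ y ∈ L, (∀ x ∈ s, x.1 < y.1) ∧ (∀ x ∈ u, x.1 < y.1) ∧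
      ∀ x ∈ v.head?, x.1 < y.1) →
    monotoneAux φ s (u ++ (L ++ v)) = monotoneAux φ [] L * monotoneAux φ s (u ++ v) := by
  induction u with
  | nil =>
    intro s h
    exact monotoneAux_append φ v s L [] (by simp) fun y hy => ⟨(h y hy).1, (h y hy).2.2⟩
  | cons x u ih =>
    intro s h
    have hu : ∀ y ∈ L, x.1 < y.1 ∧ ∀ x ∈ u, x.1 < y.1 := fun y hy =>
      List.forall_mem_cons.1 (h y hy).2.1
    induction s with
    | nil =>
      rw [List.cons_append, monotoneAux_nil_cons, List.cons_append, monotoneAux_nil_cons]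
      exact ih [x] fun y hy => ⟨by simpa using (hu y hy).1, (hu y hy).2, (h y hy).2.2⟩
    | cons z s ihs =>
      have hs : ∀ y ∈ L, z.1 < y.1 ∧ ∀ x ∈ s, x.1 < y.1 := fun y hy =>
        List.forall_mem_cons.1 (h y hy).1
      have h1 := ih (x :: z :: s) fun y hy =>
        ⟨List.forall_mem_cons.2 ⟨(hu y hy).1, (h y hy).1⟩, (hu y hy).2, (h y hy).2.2⟩
      have h2 := ih ((z.1, z.2 * x.2) :: s) fun y hy =>
        ⟨List.forall_mem_cons.2 ⟨(hs y hy).1, (hs y hy).2⟩, (hu y hy).2, (h y hy).2.2⟩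
      have h3 := ihs fun y hy => ⟨(hs y hy).2, (h y hy).2⟩
      simp only [List.cons_append] at h3
      simp only [List.cons_append, monotoneAux_cons_cons, h1, h2, h3]
      split_ifs <;> ring

end Words

namespace Words

/-- Complementary subwords are relabelled independently of each other, even if their letters are
interlaced. -/
theorem dotSum_mul_filter {A B : Type*} [CommRing B] (N : ℕ) (p : ℕ → Bool) (w : List (ℕ × A)) : ∀ f g : List (ℕ × A) → B,
    dotSum N w (fun v => f (v.filter fun x => p (x.1 / N)) * g (v.filter fun x => !p (x.1 / N)))
      = dotSum N (w.filter fun x => p x.1) f * dotSum N (w.filter fun x => !p x.1) g := by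
  induction w with
  | nil => intro f g; rfl
  | cons x w ih =>
    intro f g
    have hdiv : ∀ m ∈ Finset.range N, (N * x.1 + m) / N = x.1 := fun m hm => by
      have hm' := Finset.mem_range.1 hm
      rw [Nat.mul_add_div (by omega), Nat.div_eq_of_lt hm', add_zero]
    cases hp : p x.1
    · rw [List.filter_cons_of_neg (by simp [hp]), List.filter_cons_of_pos (by simp [hp]), dotSum,
        dotSum, Finset.mul_sum]
      refine Finset.sum_congr rfl fun m hm => ?_
      rw [← ih]
      simp [hdiv m hm, hp]
    · rw [List.filter_cons_of_pos (by simp [hp]), List.filter_cons_of_neg (by simp [hp]), dotSum,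
        dotSum, Finset.sum_mul]
      refine Finset.sum_congr rfl fun m hm => ?_
      rw [← ih]
      simp [hdiv m hm, hp]

end Words

section Systems

open OrderedSetPartition Words

variable {A : Type u} {B : Type v} [Ring A] [Algebra ℂ A] [CommRing B] [Algebra ℂ B]
  (φ : A →ₗ[ℂ] B) {n : ℕ} (π : OrderedSetPartition n) (X : Fin n → A)

theorem booleanSystem_wordExpect (w : List (ℕ × A)) :
    (booleanSystem φ).wordExpect w = boolean φ w :=
  booleanExpect_word φ w

theorem monotoneSystem_wordExpect (w : List (ℕ × A)) :
    (monotoneSystem φ).wordExpect w = monotoneAux φ [] w :=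
  monotoneExpect_word φ w

theorem booleanSystem_cumulant :
    (π.IsInterval → (booleanSystem φ).cumulant π X = (booleanSystem φ).mulCumulant π X) ∧
    (¬ π.IsInterval → (booleanSystem φ).cumulant π X = 0) := by
  have : IsTrans ℕ fun _ _ => False := ⟨fun _ _ _ h => h.elim⟩
  have : Std.Irrefl fun _ _ : ℕ => False := ⟨fun _ h => h⟩
  rw [isInterval_iff π X, not_not]
  refine (booleanSystem φ).cumulant_of_runs (fun _ _ => False)
    (fun N i u L v hu hL hv => ?_) π X
  -- In the Boolean case the stack never holds more than one run, so nothing lies below.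
  have hu' : u = [] := List.eq_nil_iff_forall_not_mem.2 hu
  subst hu'
  simp only [List.nil_append, booleanSystem_wordExpect]
  exact boolean_append φ L v fun y hy x hx e => (hv x hx).1 (e ▸ hL y hy)

theorem monotoneSystem_cumulant :
    (π.IsMonotone → (monotoneSystem φ).cumulant π X = (monotoneSystem φ).mulCumulant π X) ∧
    (¬ π.IsMonotone → (monotoneSystem φ).cumulant π X = 0) := by
  rw [isMonotone_iff π X, not_not]
  refine (monotoneSystem φ).cumulant_of_runs (· < ·) (fun N i u L v hu hL hv => ?_) π X
  simp only [monotoneSystem_wordExpect, List.append_assoc]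
  refine monotoneAux_append_append φ v L u [] fun y hy => ⟨by simp, fun x hx => ?_, fun x hx => ?_⟩
  · have := hu x hx
    rw [← hL y hy] at this
    exact Nat.lt_of_div_lt_div this
  · have := hv x hx
    rw [← hL y hy] at this
    exact Nat.lt_of_div_lt_div (lt_of_le_of_ne (not_lt.1 this.2) this.1)

/-! ### The tensor system -/

theorem tensorSystem_wordExpect (hφ : φ 1 = 1) (w : List (ℕ × A)) :
    (tensorSystem φ hφ).wordExpect w = ∏ᶠ j, φ (InfiniteTensor.component w j) :=
  InfiniteTensor.expect_word φ hφ w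

/-- Since `p` depends only on the label, each component lies entirely in one of the two subwords; in
the other subword it is `1` and contributes `φ 1 = 1`. -/
theorem finprod_component_filter (hφ : φ 1 = 1) (p : ℕ → Bool) (w : List (ℕ × A)) :
    ∏ᶠ j, φ (InfiniteTensor.component w j)
      = (∏ᶠ j, φ (InfiniteTensor.component (w.filter fun x => p x.1) j))
        * ∏ᶠ j, φ (InfiniteTensor.component (w.filter fun x => !p x.1) j) := by
  have hfin : ∀ w : List (ℕ × A),
      (Function.mulSupport fun j => φ (InfiniteTensor.component w j)).Finite := fun w =>
    (InfiniteTensor.finite_component w).subset fun j hj h1 => hj (by simp [h1, hφ])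
  rw [← finprod_mul_distrib (hfin _) (hfin _)]
  refine finprod_congr fun j => ?_
  have hc : ∀ q : ℕ → Bool, InfiniteTensor.component (w.filter fun x => q x.1) j
      = if q j then InfiniteTensor.component w j else 1 := by
    intro q
    induction w with
    | nil => simp [InfiniteTensor.component]
    | cons x w ih =>
      unfold InfiniteTensor.component at ih ⊢
      by_cases hq : q x.1 <;> by_cases hx : x.1 = j
      · subst hx
        simp only [List.filter_filter, hq, if_true] at ih ⊢
        simp [hq, ih]
      · simpa [hq, hx] using ih
      · subst hx
        simpa [hq] using ih
      · simpa [hq, hx] using ih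
  rw [hc p, hc fun j => !p j]
  cases p j <;> simp [hφ]

/-- The blocks are split off one at a time, beginning with the largest label: after relabelling,
different blocks never share a copy of `A`. -/
theorem tensorSystem_dotSum (hφ : φ 1 = 1) (N p : ℕ) : ∀ w : List (ℕ × A),
    (∀ x ∈ w, x.1 < p) → dotSum N w (tensorSystem φ hφ).wordExpect
      = ∏ a ∈ Finset.range p,
        ((tensorSystem φ hφ).listPolynomial (sub w a)).eval (N : B) := by
  induction p with
  | zero =>
    intro w hw
    have : w = [] := List.eq_nil_iff_forall_not_mem.2 fun x hx => by simpa using hw x hx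
    subst this
    simpa [dotSum, SpreadabilitySystem.wordExpect] using (tensorSystem φ hφ).expect_one
  | succ p ih =>
    intro w hw
    have hmul : dotSum N w (tensorSystem φ hφ).wordExpect
        = dotSum N (w.filter fun x => decide (x.1 < p)) (tensorSystem φ hφ).wordExpect
          * dotSum N (w.filter fun x => !decide (x.1 < p)) (tensorSystem φ hφ).wordExpect := by
      rw [← dotSum_mul_filter N (fun j => decide (j < p))]
      congr 1
      funext v
      simp only [tensorSystem_wordExpect]
      exact finprod_component_filter φ hφ (fun j => decide (j / N < p)) v
    rw [hmul, ih _ (by simp), Finset.prod_range_succ]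
    congr 1
    · refine Finset.prod_congr rfl fun a ha => ?_
      rw [sub, sub, List.filter_filter]
      congr 3
      refine List.filter_congr fun x _ => ?_
      have := Finset.mem_range.1 ha
      by_cases hx : x.1 = a <;> simp [hx, this]
    · rw [SpreadabilitySystem.eval_listPolynomial' _ _ N p, sub, List.map_map]
      congr 1
      have h1 : (w.filter fun x => !decide (x.1 < p)) = w.filter fun x => decide (x.1 = p) := by
        refine List.filter_congr fun x hx => ?_
        have := hw x hx
        rw [← decide_not]
        exact decide_eq_decide.2 ⟨fun h => by omega, fun h => by omega⟩
      rw [h1]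
      refine (List.map_id _).symm.trans (List.map_congr_left fun x hx => ?_)
      have : x.1 = p := by simpa using (List.mem_filter.1 hx).2
      exact Prod.ext this rfl

theorem tensorSystem_cumulant (hφ : φ 1 = 1) :
    (tensorSystem φ hφ).cumulant π X = (tensorSystem φ hφ).mulCumulant π X :=
  SpreadabilitySystem.cumulant_eq_mulCumulant _ π X fun N =>
    tensorSystem_dotSum φ hφ N π.size (π.word X) fun x hx =>
      (π.mem_word X x.1).1 (List.mem_map_of_mem hx)

end Systems

/-! ### Sums over noncrossing partitions -/

namespace Words

section NoncrossingSum

variable {A : Type*} {B : Type*} [CommRing B]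

/-- The sum of `t ^ #ρ * ∏_{P ∈ ρ} k (X_P)` over the noncrossing partitions `ρ` of a word that are
finer than the partition defined by the labels. The letters are read from left to right, and the
blocks which are not yet complete are kept on the stack `s`, whose blocks contribute no factor
`t`. -/
def ncSum (t : B) (k : List A → B) : List (ℕ × List A) → List (ℕ × A) → B
  | [], [] => 1
  | _ :: _, [] => 0
  | [], (j, b) :: w => t * (k [b] * ncSum t k [] w + ncSum t k [(j, [b])] w)
  | (i, L) :: s, (j, b) :: w =>
    t * (k [b] * ncSum t k ((i, L) :: s) w + ncSum t k ((j, [b]) :: (i, L) :: s) w)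
      + if i = j then k (L ++ [b]) * ncSum t k s w + ncSum t k ((i, L ++ [b]) :: s) w else 0

theorem map_ncSum {C : Type*} [CommRing C] (f : B →+* C) (t : B) (k : List A → B)
    (w : List (ℕ × A)) : ∀ s, f (ncSum t k s w) = ncSum (f t) (fun L => f (k L)) s w := by
  induction w with
  | nil => intro s; cases s <;> simp [ncSum]
  | cons x w ih =>
    intro s
    cases s with
    | nil => simp [ncSum, ih]
    | cons y s =>
      simp only [ncSum, map_add, map_mul, ih]
      split_ifs <;> simp [ih]

/-- An incomplete block can receive at most the letters that are still to be read, so `k` is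
evaluated only on lists shorter than `m`. -/
theorem ncSum_congr (t : B) (k k' : List A → B) (m : ℕ)
    (h : ∀ L, L.length < m → k L = k' L) (w : List (ℕ × A)) : ∀ s : List (ℕ × List A),
    w.length < m → (∀ x ∈ s, x.2.length + w.length < m) →
    ncSum t k s w = ncSum t k' s w := by
  induction w with
  | nil => intro s _ _; cases s <;> simp [ncSum]
  | cons x w ih =>
    intro s hw hs
    rw [List.length_cons] at hw hs
    cases s with
    | nil =>
      rw [ncSum, ncSum, h [x.2] (by simp; omega), ih [] (by omega) (by simp),
        ih [(x.1, [x.2])] (by omega) (by simp; omega)]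
    | cons y s =>
      have hs' := List.forall_mem_cons.1 hs
      have hs1 : ∀ z ∈ s, z.2.length + w.length < m := fun z hz => by
        have := hs'.2 z hz
        omega
      have hy : ∀ z ∈ y :: s, z.2.length + w.length < m :=
        List.forall_mem_cons.2 ⟨by omega, hs1⟩
      rw [ncSum, ncSum, h [x.2] (by simp; omega), ih (y :: s) (by omega) hy,
        ih ((x.1, [x.2]) :: y :: s) (by omega)
          (List.forall_mem_cons.2 ⟨by simp; omega, hy⟩),
        h (y.2 ++ [x.2]) (by simp; omega), ih s (by omega) hs1,
        ih ((y.1, y.2 ++ [x.2]) :: s) (by omega)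
          (List.forall_mem_cons.2 ⟨by simp; omega, hs1⟩)]

/-- The only summand with a block of length `m` is the one in which all remaining letters join the
block on the stack. -/
theorem ncSum_singleton_sub (k k' : List A → B) (m : ℕ)
    (h : ∀ L, L.length < m → k L = k' L) (w : List A) : ∀ L : List A, L ≠ [] → w ≠ [] →
    L.length + w.length = m →
    ncSum 1 k [(0, L)] (w.map fun a => (0, a)) + k' (L ++ w)
      = ncSum 1 k' [(0, L)] (w.map fun a => (0, a)) + k (L ++ w) := by
  induction w with
  | nil => intro L _ hw; exact absurd rfl hw
  | cons b w ih =>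
    intro L hL _ hm
    have hpos := List.length_pos_iff.2 hL
    rw [List.length_cons] at hm
    rw [List.map_cons, ncSum, ncSum, if_pos rfl, if_pos rfl, h [b] (by simp; omega),
      ncSum_congr 1 k k' m h _ [(0, L)] (by simp; omega) (by simp; omega),
      ncSum_congr 1 k k' m h _ [(0, [b]), (0, L)] (by simp; omega) (by simp; omega)]
    rcases eq_or_ne w [] with rfl | hw
    · simp only [List.map_nil, ncSum]
      ring
    · have hwpos := List.length_pos_iff.2 hw
      have := ih (L ++ [b]) (by simp) hw (by simp; omega)
      rw [h (L ++ [b]) (by simp; omega),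
        ncSum_congr 1 k k' m h _ [] (by simp; omega) (by simp)]
      simp only [List.append_assoc, List.singleton_append] at this
      linear_combination this

/-- The sum over all noncrossing partitions of `w` depends on the value at `w` only through the
summand of the one-block partition. This makes the moment-cumulant formula solvable for the highest
cumulant. -/
theorem ncSum_sub (k k' : List A → B) (w : List A) (hw : w ≠ [])
    (h : ∀ L, L.length < w.length → k L = k' L) :
    ncSum 1 k [] (w.map fun a => (0, a)) + k' w
      = ncSum 1 k' [] (w.map fun a => (0, a)) + k w := by
  cases w with
  | nil => exact absurd rfl hw
  | cons b w =>
    rw [List.map_cons, ncSum, ncSum]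
    rcases eq_or_ne w [] with rfl | hw
    · simp only [List.map_nil, ncSum]
      ring
    · have hwpos := List.length_pos_iff.2 hw
      have := ncSum_singleton_sub k k' _ h w [b] (by simp) hw (by simp; omega)
      rw [h [b] (by simp; omega), ncSum_congr 1 k k' _ h _ [] (by simp) (by simp)]
      simp only [List.singleton_append] at this
      linear_combination this

theorem dotSum_add (N : ℕ) (w : List (ℕ × A)) : ∀ f g : List (ℕ × A) → B,
    dotSum N w (fun v => f v + g v) = dotSum N w f + dotSum N w g := by
  induction w with
  | nil => intro f g; rfl
  | cons x w ih =>
    intro f g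
    simp only [dotSum, ih, Finset.sum_add_distrib]

/-- A letter that opens a block may take any of its `N` new labels, which yields the factor `N`; a
letter that joins a block has no choice left. Positivity is needed because for `N = 0` letters could
still join blocks on the stack on the right-hand side. -/
theorem dotSum_ncSum_of_pos (N : ℕ) (hN : 0 < N) (k : List A → B) (w : List (ℕ × A)) :
    ∀ s : List (ℕ × List A), dotSum N w (ncSum 1 k s)
      = ncSum (N : B) k (s.map fun x => (x.1 / N, x.2)) w := by
  induction w with
  | nil => intro s; cases s <;> simp [dotSum, ncSum]
  | cons x w ih =>
    intro s
    have hdiv : ∀ m ∈ Finset.range N, (N * x.1 + m) / N = x.1 := fun m hm => by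
      rw [Nat.mul_add_div hN, Nat.div_eq_of_lt (Finset.mem_range.1 hm), add_zero]
    cases s with
    | nil =>
      simp only [dotSum, ncSum, one_mul, List.map_nil]
      rw [Finset.sum_congr rfl fun m hm => by
        rw [dotSum_add, dotSum_mul_left, ih, ih, List.map_cons, hdiv m hm]]
      simp [mul_add]
    | cons y s =>
      simp only [dotSum, ncSum, one_mul, List.map_cons]
      have key : ∀ m ∈ Finset.range N, dotSum N w (fun v =>
          k [x.2] * ncSum 1 k (y :: s) v + ncSum 1 k ((N * x.1 + m, [x.2]) :: y :: s) v
            + if y.1 = N * x.1 + m then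
                k (y.2 ++ [x.2]) * ncSum 1 k s v + ncSum 1 k ((y.1, y.2 ++ [x.2]) :: s) v
              else 0)
          = (k [x.2] * ncSum (N : B) k ((y :: s).map fun x => (x.1 / N, x.2)) w
            + ncSum (N : B) k ((x.1, [x.2]) :: (y :: s).map fun x => (x.1 / N, x.2)) w)
            + if y.1 = N * x.1 + m then
                k (y.2 ++ [x.2]) * ncSum (N : B) k (s.map fun x => (x.1 / N, x.2)) w
                  + ncSum (N : B) k ((y.1 / N, y.2 ++ [x.2]) :: s.map fun x => (x.1 / N, x.2)) w
              else 0 := by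
        intro m hm
        have h1 := ih ((N * x.1 + m, [x.2]) :: y :: s)
        rw [List.map_cons, hdiv m hm] at h1
        rw [dotSum_add, dotSum_add, dotSum_mul_left, h1]
        congr 1
        · rw [← ih]
        · split_ifs
          · rw [dotSum_add, dotSum_mul_left, ih, ih, List.map_cons]
          · simpa using dotSum_mul_left N (0 : B) w fun _ => 0
      refine (Finset.sum_congr rfl key).trans ?_
      rw [Finset.sum_add_distrib, Finset.sum_const, Finset.card_range, nsmul_eq_mul, List.map_cons]
      congr 1
      split_ifs with hy
      -- Joining the top block means `N * x.1 + m = y.1`, so `m` has to be the remainder of `y.1`.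
      · rw [Finset.sum_eq_single (y.1 % N)]
        · rw [if_pos]
          rw [← hy, Nat.div_add_mod]
        · intro m hm hne
          refine if_neg fun e => hne ?_
          rw [e, Nat.mul_add_mod, Nat.mod_eq_of_lt (Finset.mem_range.1 hm)]
        · intro h
          exact absurd (Finset.mem_range.2 (Nat.mod_lt _ hN)) h
      · refine Finset.sum_eq_zero fun m hm => if_neg fun e => hy ?_
        rw [e, hdiv m hm]

theorem dotSum_ncSum (N : ℕ) (k : List A → B) (w : List (ℕ × A)) :
    dotSum N w (ncSum 1 k []) = ncSum (N : B) k [] w := by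
  -- For `N = 0` the first letter must open a block on the empty stack, at the price of the factor
  -- `t = 0`.
  rcases Nat.eq_zero_or_pos N with rfl | hN
  · cases w with
    | nil => rfl
    | cons x w => simp [dotSum, ncSum]
  · exact dotSum_ncSum_of_pos N hN k w []

/-! ### Reading words from a single copy -/

/-- Reading a letter, as an operation on functions of the stack of incomplete blocks. -/
def readLetter (k : List A → B) (b : A) (F : List (List A) → B) : List (List A) → B
  | [] => k [b] * F [] + F [[b]]
  | L :: c => k [b] * F (L :: c) + F ([b] :: L :: c) + (k (L ++ [b]) * F c + F ((L ++ [b]) :: c))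

/-- Reading a word, starting with the empty stack. -/
def readWord (k : List A → B) (w : List A) (F : List (List A) → B) : B :=
  w.foldr (readLetter k) F []

/-- Reading a word, where only the nonempty stacks are kept. -/
def readCentred (k : List A → B) (w : List A) (F : List (List A) → B) : B :=
  readWord k w fun c => if c = [] then 0 else F c

variable (k : List A → B)

theorem readLetter_comb (b : A) (c d : B) (F G : List (List A) → B) :
    readLetter k b (fun x => c * F x + d * G x)
      = fun x => c * readLetter k b F x + d * readLetter k b G x := by
  funext x
  cases x <;> simp only [readLetter] <;> ring

theorem readWord_comb (w : List A) (c d : B) (F G : List (List A) → B) :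
    readWord k w (fun x => c * F x + d * G x) = c * readWord k w F + d * readWord k w G := by
  have : w.foldr (readLetter k) (fun x => c * F x + d * G x)
      = fun x => c * w.foldr (readLetter k) F x + d * w.foldr (readLetter k) G x := by
    induction w with
    | nil => rfl
    | cons b w ih => rw [List.foldr_cons, ih, readLetter_comb]; rfl
  rw [readWord, this]
  rfl

theorem readWord_concat (w : List A) (b : A) (F : List (List A) → B) :
    readWord k (w ++ [b]) F = readWord k w (readLetter k b F) := by
  simp [readWord]

theorem readCentred_singleton (b : A) (F : List (List A) → B) :
    readCentred k [b] F = F [[b]] := by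
  simp [readCentred, readWord, readLetter]

/-- Reading the words of a stack from the bottom to the top, where after each word only the
nonempty stacks are kept. -/
def readStack (k : List A → B) : List (ℕ × List A) → (List (ℕ × List A) → B) → B
  | [], G => G []
  | (i, w) :: s, G =>
    readStack k s fun c₁ => readCentred k w fun c => G ((c.map fun L => (i, L)) ++ c₁)

theorem readCentred_comb (w : List A) (c d : B) (F G : List (List A) → B) :
    readCentred k w (fun x => c * F x + d * G x)
      = c * readCentred k w F + d * readCentred k w G := by
  rw [readCentred, readCentred, readCentred, ← readWord_comb]
  congr 1
  funext x
  split_ifs <;> ring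

theorem readStack_comb (s : List (ℕ × List A)) (c d : B) : ∀ F G : List (ℕ × List A) → B,
    readStack k s (fun x => c * F x + d * G x) = c * readStack k s F + d * readStack k s G := by
  induction s with
  | nil => intro F G; rfl
  | cons y s ih =>
    intro F G
    simp only [readStack, readCentred_comb, ih]

theorem readCentred_congr (w : List A) (F G : List (List A) → B)
    (h : ∀ L c, F (L :: c) = G (L :: c)) :
    readCentred k w F = readCentred k w G := by
  rw [readCentred, readCentred]
  congr 1
  funext c
  cases c with
  | nil => rfl
  | cons L c => simp [h]

/-- Reading the top word leaves at least one incomplete block with label `i`, so only such stacks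
are seen. -/
theorem readStack_congr (i : ℕ) (w : List A) (s : List (ℕ × List A))
    (F G : List (ℕ × List A) → B) (h : ∀ L c, F ((i, L) :: c) = G ((i, L) :: c)) :
    readStack k ((i, w) :: s) F = readStack k ((i, w) :: s) G := by
  rw [readStack, readStack]
  congr 1
  funext c₁
  exact readCentred_congr k w _ _ fun L c => h L _

/-- A single letter that must leave an incomplete block can only open one. -/
theorem readStack_push (j : ℕ) (b : A) (s : List (ℕ × List A)) (G : List (ℕ × List A) → B) :
    readStack k ((j, [b]) :: s) G = readStack k s fun c => G ((j, [b]) :: c) := by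
  rw [readStack]
  simp only [readCentred_singleton, List.map_cons, List.map_nil, List.singleton_append]

end NoncrossingSum

/-! ### The free moment-cumulant formula -/

section FreeCumulant

variable {A : Type u} {B : Type v} [Ring A] [Algebra ℂ A] [CommRing B] [Algebra ℂ B]
  (φ : A →ₗ[ℂ] B)

/-- The free cumulants, defined recursively by the moment-cumulant formula. -/
noncomputable def freeCumulant (w : List A) : B :=
  φ w.prod - ncSum 1 (fun L => if _ : L.length < w.length then freeCumulant L else 0) []
    (w.map fun a => (0, a))
  termination_by w.length

/-- The truncated function in the recursion vanishes at `w`, so by `ncSum_sub` removing the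
truncation adds exactly the term `freeCumulant φ w`. -/
theorem ncSum_freeCumulant (hφ : φ 1 = 1) (w : List A) :
    ncSum 1 (freeCumulant φ) [] (w.map fun a => (0, a)) = φ w.prod := by
  rcases eq_or_ne w [] with rfl | hw
  · simp [ncSum, hφ]
  · have := ncSum_sub (freeCumulant φ)
      (fun L => if _ : L.length < w.length then freeCumulant φ L else 0) w hw
      fun L hL => by simp only [dif_pos hL]
    rw [dif_neg (lt_irrefl _), add_zero] at this
    rw [this]
    conv_lhs => rw [freeCumulant.eq_def φ w]
    ring

variable (k : List A → B)

/-- The readings that leave no incomplete block are the noncrossing partitions of `w`. -/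
theorem readWord_empty (hk : ∀ w : List A, ncSum 1 k [] (w.map fun a => (0, a)) = φ w.prod)
    (w : List A) : readWord k w (fun c => if c = [] then 1 else 0) = φ w.prod := by
  have key : ∀ c : List (List A), w.foldr (readLetter k) (fun c => if c = [] then 1 else 0) c
      = ncSum 1 k (c.map fun L => (0, L)) (w.map fun a => (0, a)) := by
    induction w with
    | nil => intro c; cases c <;> simp [ncSum]
    | cons b w ih =>
      intro c
      have : w.foldr (readLetter k) (fun c => if c = [] then 1 else 0)
          = fun c => ncSum 1 k (c.map fun L => (0, L)) (w.map fun a => (0, a)) := funext ih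
      rw [List.foldr_cons, this]
      cases c <;> simp [ncSum, readLetter]
  rw [readWord, key, ← hk]
  rfl

/-- The counterpart of `x = x° + φ(x)`: centring an element amounts to discarding the readings that
end with the empty stack. -/
theorem readWord_eq (hk : ∀ w : List A, ncSum 1 k [] (w.map fun a => (0, a)) = φ w.prod)
    (w : List A) (F : List (List A) → B) :
    readWord k w F = readCentred k w F + φ w.prod * F [] := by
  rw [← readWord_empty φ k hk, readCentred]
  have := readWord_comb k w 1 (F []) (fun c => if c = [] then 0 else F c)
    (fun c => if c = [] then 1 else 0)
  rw [one_mul, mul_comm (F [])] at this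
  rw [← this]
  congr 1
  funext c
  split_ifs with h
  · rw [h]; ring
  · ring

/-- The counterpart of `x° b = φ(x b) - φ(x) φ(b) + (x b)° - φ(x) b°`, the rule behind `freeAux`. It
results from expanding the reading of `w ++ [b]` by `readWord_eq` as a whole and after `w`. -/
theorem readCentred_concat (hk : ∀ w : List A, ncSum 1 k [] (w.map fun a => (0, a)) = φ w.prod)
    (w : List A) (b : A) (F : List (List A) → B) :
    readCentred k w (readLetter k b F)
      = (φ (w.prod * b) - φ w.prod * φ b) * F [] + readCentred k (w ++ [b]) F
        - φ w.prod * readCentred k [b] F := by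
  have h1 := readWord_eq φ k hk w (readLetter k b F)
  have h2 := readWord_eq φ k hk (w ++ [b]) F
  have h3 := readWord_eq φ k hk [b] F
  have h4 : readWord k [b] F = readLetter k b F [] := rfl
  rw [← readWord_concat, h2, ← h4, h3] at h1
  simp only [List.prod_append, List.prod_singleton] at h1
  linear_combination -h1

/-- Both sides obey the same recursion in the first letter of `w`. A centred element on the stack of
`freeAux` corresponds to a word read in such a way that some block stays incomplete. A letter from
another copy then finds a top block it cannot join, so it is a singleton or opens a block; for a
letter from the same copy the recursion is `readCentred_concat`. At the end of `w` an incomplete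
block forces the value `0`. -/
theorem freeAux_eq_readStack
    (hk : ∀ w : List A, ncSum 1 k [] (w.map fun a => (0, a)) = φ w.prod)
    (w : List (ℕ × A)) : ∀ s : List (ℕ × List A),
    freeAux φ (s.map fun x => (x.1, x.2.prod)) w = readStack k s fun c => ncSum 1 k c w := by
  have hk1 : ∀ b, k [b] = φ b := fun b => by simpa [ncSum] using hk [b]
  induction w with
  | nil =>
    intro s
    cases s with
    | nil => rfl
    | cons y s =>
      -- Zero is written as a combination with zero coefficients so that linearity of `readStack`
      -- gives the value `0`.
      rw [readStack_congr k y.1 y.2 s (fun c => ncSum 1 k c []) (fun _ => 0 * 0 + 0 * 0)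
        fun L c => by simp [ncSum], readStack_comb]
      simp [freeAux]
  | cons x w ih =>
    intro s
    cases s with
    | nil =>
      have h1 := ih []
      have h2 := ih [(x.1, [x.2])]
      rw [readStack_push] at h2
      simp only [List.map_nil, List.map_cons, List.prod_singleton, readStack] at h1 h2
      simp only [List.map_nil, freeAux, readStack, ncSum, h1, h2, hk1]
      ring
    | cons y s =>
      obtain ⟨i, W⟩ := y
      obtain ⟨j, b⟩ := x
      rw [List.map_cons, freeAux]
      split_ifs with hij
      · subst hij
        have h1 := ih s
        have h2 := ih ((i, W ++ [b]) :: s)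
        have h3 := ih ((i, [b]) :: s)
        simp only [List.map_cons, List.prod_append, List.prod_singleton] at h2 h3
        rw [h1, h2, h3, readStack, readStack, readStack]
        -- The factors `1` bring the right-hand side into the form of two nested binary
        -- combinations, as required by `readStack_comb`.
        have key : ∀ c₁, readCentred k W (fun c =>
              ncSum 1 k ((c.map fun L => (i, L)) ++ c₁) ((i, b) :: w))
            = (φ (W.prod * b) - φ W.prod * φ b) * ncSum 1 k c₁ w
              + 1 * (1 * readCentred k (W ++ [b])
                  (fun c => ncSum 1 k ((c.map fun L => (i, L)) ++ c₁) w)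
                + (- φ W.prod) * readCentred k [b]
                  (fun c => ncSum 1 k ((c.map fun L => (i, L)) ++ c₁) w)) := by
          intro c₁
          have := readCentred_concat φ k hk W b
            fun c => ncSum 1 k ((c.map fun L => (i, L)) ++ c₁) w
          rw [readCentred_congr k W _ (readLetter k b
            fun c => ncSum 1 k ((c.map fun L => (i, L)) ++ c₁) w) fun L c => by
              simp [ncSum, readLetter], this]
          simp only [List.map_nil, List.nil_append]
          ring
        simp only [key]
        rw [readStack_comb, readStack_comb]
        ring
      · have h1 := ih ((i, W) :: s)
        have h2 := ih ((j, [b]) :: (i, W) :: s)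
        rw [readStack_push] at h2
        simp only [List.map_cons, List.prod_singleton] at h1 h2
        rw [h1, h2, readStack_congr k i W s (fun c => ncSum 1 k c ((j, b) :: w))
          (fun c => φ b * ncSum 1 k c w + 1 * ncSum 1 k ((j, [b]) :: c) w) fun L c => by
            simp [ncSum, hij, hk1], readStack_comb, one_mul]

/-- The moment-cumulant formula for words from several copies. That no block contains letters of
different labels is the vanishing of mixed free cumulants. -/
theorem freeAux_eq_ncSum (hφ : φ 1 = 1) (w : List (ℕ × A)) :
    freeAux φ [] w = ncSum 1 (freeCumulant φ) [] w :=
  freeAux_eq_readStack φ _ (ncSum_freeCumulant φ hφ) w []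

end FreeCumulant

end Words

/-! ### The leading coefficient of the sum over noncrossing partitions -/

namespace Words

/-- Two labels cross. -/
def HasCrossing (l : List ℕ) : Prop :=
  ∃ a b, a ≠ b ∧ [a, b, a, b].Sublist l

theorem hasCrossing_append_cons_cons (i : ℕ) (u w : List ℕ) :
    HasCrossing (u ++ i :: i :: w) ↔ HasCrossing (u ++ i :: w) := by
  refine ⟨fun ⟨a, b, hab, h⟩ => ⟨a, b, hab, ?_⟩, fun ⟨a, b, hab, h⟩ => ⟨a, b, hab, ?_⟩⟩
  · exact sublist_of_sublist_cons_cons (by simp [hab, hab.symm]) h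
  · exact h.trans ((List.Sublist.refl u).append (List.sublist_cons_self _ _))

/-- Both labels of a crossing occur twice, which `i` does not. -/
theorem hasCrossing_append_cons {i : ℕ} {u w : List ℕ} (hu : i ∉ u) (hw : i ∉ w) :
    HasCrossing (u ++ i :: w) ↔ HasCrossing (u ++ w) := by
  refine ⟨fun ⟨a, b, hab, h⟩ => ⟨a, b, hab, ?_⟩, fun ⟨a, b, hab, h⟩ => ⟨a, b, hab, ?_⟩⟩
  · have hc := h.count_le i
    have hc' : (u ++ i :: w).count i = 1 := by
      simp [List.count_append, List.count_eq_zero_of_not_mem hu, List.count_eq_zero_of_not_mem hw]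
    rw [hc'] at hc
    have hai : a ≠ i := by
      rintro rfl
      simp [hab.symm] at hc
    have hbi : b ≠ i := by
      rintro rfl
      simp [hab] at hc
    have hf := h.filter (fun x => decide (x ≠ i))
    have h1 : u.filter (fun x => decide (x ≠ i)) = u :=
      List.filter_eq_self.2 fun x hx => by simpa using ne_of_mem_of_not_mem hx hu
    have h2 : w.filter (fun x => decide (x ≠ i)) = w :=
      List.filter_eq_self.2 fun x hx => by simpa using ne_of_mem_of_not_mem hx hw
    rw [List.filter_append, h1, List.filter_cons_of_neg (a := i) (by simp), h2] at hf
    simpa [hai, hbi] using hf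
  · exact h.trans ((List.Sublist.refl u).append (List.sublist_cons_self _ _))

/-- The word `w` can be read without a crossing, where `s` lists the labels of the incomplete
blocks and `t` is the set of labels that have been seen. -/
def Readable (t : Finset ℕ) (s w : List ℕ) : Prop :=
  (∀ j ∈ t, j ∈ w → j ∈ s) ∧ (∀ j ∈ s, j ∈ w) ∧ ¬ HasCrossing (s.reverse ++ w)

/-! ### Readability under the moves of a letter: open, open and close, join, close -/

section Readable

variable {t : Finset ℕ} {s w : List ℕ} {j : ℕ}

theorem readable_nil_nil : Readable t [] [] :=
  ⟨by simp, by simp, by rintro ⟨a, b, -, h⟩; simp at h⟩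

theorem readable_open (hs : ∀ i ∈ s, i ∈ t) (hj : j ∉ t) (hw : j ∈ w) :
    Readable (insert j t) (j :: s) w ↔ Readable t s (j :: w) := by
  have hne : ∀ i ∈ t, i ≠ j := fun i hi => ne_of_mem_of_not_mem hi hj
  rw [Readable, Readable, List.reverse_cons, List.append_assoc, List.singleton_append]
  refine and_congr ?_ (and_congr ?_ Iff.rfl)
  · simp only [Finset.mem_insert, List.mem_cons]
    constructor
    · intro h i hi hiw
      have := hne i hi
      have := h i (Or.inr hi) (by tauto)
      tauto
    · rintro h i (rfl | hi) hiw
      · exact Or.inl rfl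
      · exact Or.inr (h i hi (Or.inr hiw))
  · simp only [List.mem_cons]
    constructor
    · intro h i hi
      exact Or.inr (h i (Or.inr hi))
    · rintro h i (rfl | hi)
      · exact hw
      · have := hne i (hs i hi)
        have := h i hi
        tauto

theorem readable_open_close (hs : ∀ i ∈ s, i ∈ t) (hj : j ∉ t) (hw : j ∉ w) :
    Readable (insert j t) s w ↔ Readable t s (j :: w) := by
  have hne : ∀ i ∈ t, i ≠ j := fun i hi => ne_of_mem_of_not_mem hi hj
  have hjs : j ∉ s := fun h => hj (hs j h)
  rw [Readable, Readable, hasCrossing_append_cons (by simpa using hjs) hw]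
  refine and_congr ?_ (and_congr ?_ Iff.rfl)
  · simp only [Finset.mem_insert, List.mem_cons]
    constructor
    · intro h i hi hiw
      have := hne i hi
      exact h i (Or.inr hi) (by tauto)
    · rintro h i (rfl | hi) hiw
      · exact absurd hiw hw
      · exact h i hi (Or.inr hiw)
  · simp only [List.mem_cons]
    refine forall₂_congr fun i hi => ?_
    have := hne i (hs i hi)
    tauto

theorem readable_join (hw : j ∈ w) : Readable t (j :: s) w ↔ Readable t (j :: s) (j :: w) := by
  simp only [Readable, List.reverse_cons, List.append_assoc, List.singleton_append]
  rw [hasCrossing_append_cons_cons]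
  refine and_congr ?_ (and_congr ?_ Iff.rfl)
  · simp only [List.mem_cons]
    refine forall₂_congr fun i hi => ?_
    tauto
  · simp only [List.mem_cons]
    refine forall₂_congr fun i hi => ?_
    constructor
    · exact Or.inr
    · rintro (rfl | h)
      · exact hw
      · exact h

theorem readable_close (hjs : j ∉ s) (hw : j ∉ w) :
    Readable t s w ↔ Readable t (j :: s) (j :: w) := by
  simp only [Readable, List.reverse_cons, List.append_assoc, List.singleton_append]
  rw [hasCrossing_append_cons_cons, hasCrossing_append_cons (by simpa using hjs) hw]
  refine and_congr ?_ (and_congr ?_ Iff.rfl)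
  · simp only [List.mem_cons]
    refine forall₂_congr fun i hi => ?_
    have : i ∈ w → i ≠ j := fun h => ne_of_mem_of_not_mem h hw
    tauto
  · simp only [List.mem_cons]
    constructor
    · rintro h i (rfl | hi)
      · exact Or.inl rfl
      · exact Or.inr (h i hi)
    · intro h i hi
      have : i ≠ j := ne_of_mem_of_not_mem hi hjs
      have := h i (Or.inr hi)
      tauto

/-- The block `j` has to be incomplete and lies below `i` on the stack, while `i` must still receive
a letter: this gives the crossing `j, i, j, i`. -/
theorem not_readable_of_ne {i : ℕ} (hj : j ∈ t) (hij : i ≠ j) :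
    ¬ Readable t (i :: s) (j :: w) := by
  rintro ⟨h1, h2, h3⟩
  have hjs : j ∈ s := by simpa [hij.symm] using h1 j hj (by simp)
  have hiw : i ∈ w := by simpa [hij] using h2 i (by simp)
  refine h3 ⟨j, i, hij.symm, ?_⟩
  rw [List.reverse_cons, List.append_assoc, List.singleton_append]
  have h4 : [j].Sublist s.reverse := by simpa using hjs
  have h5 : [i, j, i].Sublist (i :: j :: w) := by simpa using hiw
  exact h4.append h5

end Readable

/-! ### Readings with one block for each label -/

section Lead

variable {A : Type*} {B : Type*} [CommRing B] (k : List A → B)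

/-- The part of `ncSum` in which every letter opens a new block exactly when its label is not in
the set `t` of labels that have been seen. -/
def ncLead : Finset ℕ → List (ℕ × List A) → List (ℕ × A) → B
  | _, [], [] => 1
  | _, _ :: _, [] => 0
  | t, [], (j, b) :: w => if j ∈ t then 0 else
      k [b] * ncLead (insert j t) [] w + ncLead (insert j t) [(j, [b])] w
  | t, (i, L) :: s, (j, b) :: w => if j ∈ t then
      if i = j then k (L ++ [b]) * ncLead t s w + ncLead t ((i, L ++ [b]) :: s) w else 0
    else k [b] * ncLead (insert j t) ((i, L) :: s) w
      + ncLead (insert j t) ((j, [b]) :: (i, L) :: s) w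

theorem ncLead_open (t : Finset ℕ) (s : List (ℕ × List A)) (x : ℕ × A) (w : List (ℕ × A))
    (h : x.1 ∉ t) : ncLead k t s (x :: w) = k [x.2] * ncLead k (insert x.1 t) s w
      + ncLead k (insert x.1 t) ((x.1, [x.2]) :: s) w := by
  cases s <;> rw [ncLead, if_neg h]

/-- The set of labels of a word. -/
def labels (w : List (ℕ × A)) : Finset ℕ := (w.map Prod.fst).toFinset

theorem mem_labels {w : List (ℕ × A)} {j : ℕ} : j ∈ labels w ↔ j ∈ w.map Prod.fst :=
  List.mem_toFinset

theorem labels_cons_sdiff_of_mem (x : ℕ × A) (w : List (ℕ × A)) (t : Finset ℕ) (h : x.1 ∈ t) :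
    labels (x :: w) \ t = labels w \ t := by
  ext i
  simp only [Finset.mem_sdiff, mem_labels, List.map_cons, List.mem_cons]
  constructor
  · rintro ⟨rfl | hi, hit⟩
    · exact absurd h hit
    · exact ⟨hi, hit⟩
  · rintro ⟨hi, hit⟩
    exact ⟨Or.inr hi, hit⟩

theorem labels_cons_sdiff_of_not_mem (x : ℕ × A) (w : List (ℕ × A)) (t : Finset ℕ) (h : x.1 ∉ t) :
    labels (x :: w) \ t = insert x.1 (labels w \ insert x.1 t) := by
  ext i
  simp only [Finset.mem_sdiff, mem_labels, List.map_cons, List.mem_cons, Finset.mem_insert]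
  by_cases hi : i = x.1
  · subst hi; tauto
  · tauto

open Polynomial in
-- Every label that is new with respect to `t` requires a block to be opened, and every opening
-- costs a factor `X`. The lowest order is attained by the readings without further openings, which
-- are those of `ncLead`.
theorem ncSum_congr_ncLead (w : List (ℕ × A)) : ∀ (t : Finset ℕ) (s : List (ℕ × List A)),
    (∀ x ∈ s, x.1 ∈ t) →
    (X : B[X]) ^ ((labels w \ t).card + 1) ∣
      ncSum X (fun L => C (k L)) s w - X ^ (labels w \ t).card * C (ncLead k t s w) := by
  induction w with
  | nil => intro t s _; cases s <;> simp [ncSum, ncLead, labels]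
  | cons x w ih =>
    intro t s hs
    obtain ⟨j, b⟩ := x
    by_cases hj : j ∈ t
    · rw [labels_cons_sdiff_of_mem _ _ _ hj]
      set m := (labels w \ t).card
      have hdvd : ∀ s : List (ℕ × List A), (∀ x ∈ s, x.1 ∈ t) →
          (X : B[X]) ^ m ∣ ncSum X (fun L => C (k L)) s w := fun s hs => by
        have h := (pow_dvd_pow X (Nat.le_succ m)).trans (ih t s hs)
        have h' := dvd_add h (Dvd.intro (C (ncLead k t s w)) rfl)
        rwa [sub_add_cancel] at h'
      -- Opening a block for a label already seen wastes a factor `X` and does not contribute to the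
      -- lowest order.
      have hopen : ∀ s : List (ℕ × List A), (∀ x ∈ s, x.1 ∈ t) →
          (X : B[X]) ^ (m + 1) ∣ X * (C (k [b]) * ncSum X (fun L => C (k L)) s w
            + ncSum X (fun L => C (k L)) ((j, [b]) :: s) w) := fun s hs => by
        rw [pow_succ']
        exact mul_dvd_mul_left _ (dvd_add ((hdvd s hs).mul_left _)
          (hdvd _ (List.forall_mem_cons.2 ⟨hj, hs⟩)))
      cases s with
      | nil =>
        rw [ncSum, ncLead, if_pos hj, C_0, mul_zero, sub_zero]
        exact hopen [] hs
      | cons y s =>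
        obtain ⟨i, L⟩ := y
        have hs' := List.forall_mem_cons.1 hs
        rw [ncSum, ncLead, if_pos hj, add_sub_assoc]
        refine dvd_add (hopen _ hs) ?_
        split_ifs with hij
        · have h1 := (ih t s hs'.2).mul_left (C (k (L ++ [b])))
          have h2 := ih t ((i, L ++ [b]) :: s) (List.forall_mem_cons.2 hs')
          refine (dvd_add h1 h2).trans (dvd_of_eq ?_)
          rw [C_add, C_mul]
          ring
        · simp
    · have hns : j ∉ labels w \ insert j t := by simp
      rw [labels_cons_sdiff_of_not_mem _ _ _ hj, Finset.card_insert_of_notMem hns]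
      have hs1 : ∀ x ∈ s, x.1 ∈ insert j t := fun x hx => Finset.mem_insert_of_mem (hs x hx)
      have h1 := (ih (insert j t) s hs1).mul_left (C (k [b]))
      have h2 := ih (insert j t) ((j, [b]) :: s)
        (List.forall_mem_cons.2 ⟨Finset.mem_insert_self _ _, hs1⟩)
      have h3 := mul_dvd_mul_left X (dvd_add h1 h2)
      rw [← pow_succ'] at h3
      refine h3.trans (dvd_of_eq ?_)
      rw [ncLead_open k t s (j, b) w hj, C_add, C_mul]
      -- A new label cannot join the top block, because all labels on the stack are in `t`.
      have hsum : ncSum X (fun L => C (k L)) s ((j, b) :: w)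
          = X * (C (k [b]) * ncSum X (fun L => C (k L)) s w
            + ncSum X (fun L => C (k L)) ((j, [b]) :: s) w) := by
        cases s with
        | nil => rw [ncSum]
        | cons y s =>
          have hyj : y.1 ≠ j := fun e => hj (e ▸ hs y (by simp))
          rw [ncSum, if_neg hyj, add_zero]
      rw [hsum]
      ring

/-- With one block per label the reading is forced: whether a letter opens its block depends on
whether its label is new, and whether it closes it on whether the label occurs again. So at most one
summand survives, and `Readable` is the condition that it does. -/
theorem ncLead_eq (w : List (ℕ × A)) : ∀ (t : Finset ℕ) (s : List (ℕ × List A)),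
    (∀ x ∈ s, x.1 ∈ t) → (s.map Prod.fst).Nodup →
    (Readable t (s.map Prod.fst) (w.map Prod.fst) → ncLead k t s w
      = (s.map fun x => k (x.2 ++ sub w x.1)).prod * ∏ j ∈ labels w \ t, k (sub w j)) ∧
    (¬ Readable t (s.map Prod.fst) (w.map Prod.fst) → ncLead k t s w = 0) := by
  induction w with
  | nil =>
    intro t s _ _
    cases s with
    | nil => exact ⟨fun _ => by simp [ncLead, labels], fun h => absurd readable_nil_nil h⟩
    | cons y s => exact ⟨fun h => by simpa using h.2.1 y.1 (by simp), fun _ => by rw [ncLead]⟩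
  | cons x w ih =>
    intro t s hs hn
    have hsub : ∀ s : List (ℕ × List A), x.1 ∉ s.map Prod.fst →
        (s.map fun y => k (y.2 ++ sub (x :: w) y.1)) = s.map fun y => k (y.2 ++ sub w y.1) :=
      fun s h => List.map_congr_left fun y hy => by
        rw [sub_cons, if_neg fun e : x.1 = y.1 => h (e ▸ List.mem_map_of_mem hy)]
    have hs1 : ∀ i ∈ s.map Prod.fst, i ∈ t := fun i hi => by
      obtain ⟨y, hy, rfl⟩ := List.mem_map.1 hi
      exact hs y hy
    by_cases hj : x.1 ∈ t
    · have hnew : ∀ j ∈ labels w \ t, k (sub (x :: w) j) = k (sub w j) := fun j hj' => by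
        rw [sub_cons, if_neg fun e : x.1 = j => (Finset.mem_sdiff.1 hj').2 (e ▸ hj)]
      rw [labels_cons_sdiff_of_mem x w t hj, Finset.prod_congr rfl hnew]
      cases s with
      | nil =>
        exact ⟨fun h => by simpa using h.1 x.1 hj (by simp), fun _ => by rw [ncLead, if_pos hj]⟩
      | cons y s =>
        have hs' := List.forall_mem_cons.1 hs
        rw [List.map_cons, List.nodup_cons] at hn
        by_cases hij : y.1 = x.1
        · have ih1 := ih t s hs'.2 hn.2
          have ih2 := ih t ((y.1, y.2 ++ [x.2]) :: s) (List.forall_mem_cons.2 hs')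
            (List.nodup_cons.2 hn)
          rw [ncLead, if_pos hj, if_pos hij]
          rw [List.map_cons, hij] at ih2
          rw [hij] at hn
          simp only [List.map_cons, hij]
          rw [List.prod_cons, hsub s hn.1, sub_cons, if_pos rfl]
          by_cases hw : x.1 ∈ w.map Prod.fst
          -- The label occurs again, so its block may not be closed now.
          · have h1 : ¬ Readable t (s.map Prod.fst) (w.map Prod.fst) :=
              fun h => hn.1 (h.1 x.1 hj hw)
            rw [ih1.2 h1, mul_zero, zero_add, ← readable_join hw]
            simpa using ih2
          -- This is the last letter with its label, so its block may not stay incomplete.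
          · have h2 : ¬ Readable t (x.1 :: s.map Prod.fst) (w.map Prod.fst) :=
              fun h => hw (h.2.1 x.1 (by simp))
            have h3 : sub w x.1 = [] := not_not.1 fun h => hw (sub_ne_nil.1 h)
            rw [ih2.2 h2, add_zero, ← readable_close hn.1 hw, h3]
            exact ⟨fun h => by rw [ih1.1 h, mul_assoc], fun h => by rw [ih1.2 h, mul_zero]⟩
        · rw [ncLead, if_pos hj, if_neg hij]
          exact ⟨fun h => absurd h (not_readable_of_ne hj hij), fun _ => rfl⟩
    · have hxs : x.1 ∉ s.map Prod.fst := fun h => hj (hs1 _ h)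
      have hs2 : ∀ y ∈ s, y.1 ∈ insert x.1 t := fun y hy => Finset.mem_insert_of_mem (hs y hy)
      have ih1 := ih (insert x.1 t) s hs2 hn
      have ih2 := ih (insert x.1 t) ((x.1, [x.2]) :: s)
        (List.forall_mem_cons.2 ⟨Finset.mem_insert_self _ _, hs2⟩) (List.nodup_cons.2 ⟨hxs, hn⟩)
      have hnew : ∀ j ∈ labels w \ insert x.1 t, k (sub (x :: w) j) = k (sub w j) :=
        fun j hj' => by
          rw [sub_cons, if_neg fun e : x.1 = j =>
            (Finset.mem_sdiff.1 hj').2 (e ▸ Finset.mem_insert_self _ _)]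
      rw [ncLead_open k t s x w hj, labels_cons_sdiff_of_not_mem x w t hj,
        Finset.prod_insert (by simp), Finset.prod_congr rfl hnew, hsub s hxs, sub_cons, if_pos rfl]
      rw [List.map_cons, List.map_cons, List.prod_cons] at ih2
      by_cases hw : x.1 ∈ w.map Prod.fst
      · have h1 : ¬ Readable (insert x.1 t) (s.map Prod.fst) (w.map Prod.fst) :=
          fun h => hxs (h.1 x.1 (Finset.mem_insert_self _ _) hw)
        rw [ih1.2 h1, mul_zero, zero_add, List.map_cons, ← readable_open hs1 hj hw]
        refine ⟨fun h => ?_, ih2.2⟩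
        rw [ih2.1 h, List.singleton_append]
        ring
      · have h2 : ¬ Readable (insert x.1 t) (x.1 :: s.map Prod.fst) (w.map Prod.fst) :=
          fun h => hw (h.2.1 x.1 (by simp))
        have h3 : sub w x.1 = [] := not_not.1 fun h => hw (sub_ne_nil.1 h)
        rw [ih2.2 h2, add_zero, List.map_cons, ← readable_open_close hs1 hj hw, h3]
        refine ⟨fun h => ?_, fun h => by rw [ih1.2 h, mul_zero]⟩
        rw [ih1.1 h]
        ring

open Polynomial in
-- With no label seen and the empty stack, being readable means having no crossing; the lowest-order
-- term then comes from the partition into the labels themselves.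
theorem coeff_ncSum (w : List (ℕ × A)) :
    (¬ HasCrossing (w.map Prod.fst) →
      (ncSum (X : B[X]) (fun L => C (k L)) [] w).coeff (labels w).card
        = ∏ j ∈ labels w, k (sub w j)) ∧
    (HasCrossing (w.map Prod.fst) →
      (ncSum (X : B[X]) (fun L => C (k L)) [] w).coeff (labels w).card = 0) := by
  have h1 := X_pow_dvd_iff.1 (ncSum_congr_ncLead k w ∅ [] (by simp)) _ (Nat.lt_succ_self _)
  rw [coeff_sub, coeff_X_pow_mul', if_pos le_rfl, Nat.sub_self, coeff_C_zero, sub_eq_zero,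
    Finset.sdiff_empty] at h1
  have h2 := ncLead_eq k w ∅ [] (by simp) List.nodup_nil
  have h3 : Readable ∅ ([] : List ℕ) (w.map Prod.fst) ↔ ¬ HasCrossing (w.map Prod.fst) := by
    simp [Readable]
  rw [List.map_nil, h3, List.map_nil, List.prod_nil, one_mul, Finset.sdiff_empty, not_not] at h2
  rw [h1]
  exact h2

end Lead

end Words

/-! ### The free system -/

namespace OrderedSetPartition

variable {n : ℕ}

theorem isNoncrossing_iff {A : Type*} (π : OrderedSetPartition n) (X : Fin n → A) :
    π.IsNoncrossing ↔ ¬ Words.HasCrossing ((π.word X).map Prod.fst) := by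
  simp only [Words.HasCrossing, map_fst_word, Words.sublist_ofFn]
  constructor
  · rintro h ⟨a, b, hab, js, hjs, e⟩
    obtain ⟨i, j, k, l, rfl⟩ := List.length_eq_four.1 (show js.length = 4 by
      simpa using (congrArg List.length e).symm)
    simp only [List.map_cons, List.map_nil, List.cons.injEq, and_true] at e
    obtain ⟨rfl, rfl, e1, e2⟩ := e
    simp only [List.pairwise_cons, List.mem_cons] at hjs
    exact hab (congrArg _ (h i j k l (hjs.1 _ (Or.inl rfl)) (hjs.2.1 _ (Or.inl rfl))
      (hjs.2.2.1 _ (Or.inl rfl)) (Fin.ext e1) (Fin.ext e2)))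
  · intro h i j k l hij hjk hkl hik hjl
    by_contra hne
    refine h ⟨π.idx i, π.idx j, fun e => hne (Fin.ext e), [i, j, k, l], ?_, ?_⟩
    · simp [hij, hjk, hkl, hij.trans hjk, hjk.trans hkl, (hij.trans hjk).trans hkl]
    · simp [hik, hjl]

end OrderedSetPartition

section Systems

open OrderedSetPartition Words Polynomial

variable {A : Type u} {B : Type v} [Ring A] [Algebra ℂ A] [CommRing B] [Algebra ℂ B]
  (φ : A →ₗ[ℂ] B) (hφ : φ 1 = 1)

theorem freeSystem_eval_ncSum (N : ℕ) (w : List (ℕ × A)) :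
    (ncSum (X : B[X]) (fun L => C (freeCumulant φ L)) [] w).eval (N : B)
      = dotSum N w (freeSystem φ hφ).wordExpect := by
  have h : (freeSystem φ hφ).wordExpect = ncSum 1 (freeCumulant φ) [] :=
    funext fun v => (freeExpect_word φ hφ v).trans (freeAux_eq_ncSum φ hφ v)
  rw [h, dotSum_ncSum, ← coe_evalRingHom, map_ncSum]
  simp

/-- Identifies the recursively defined free cumulants with the cumulants `K_m` of the system, as the
case of one label, which cannot cross anything. -/
theorem freeSystem_listPolynomial_coeff {L : List A} (hL : L ≠ []) :
    ((freeSystem φ hφ).listPolynomial L).coeff 1 = freeCumulant φ L := by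
  have h : (freeSystem φ hφ).listPolynomial L
      = ncSum X (fun L => C (freeCumulant φ L)) [] (L.map fun a => (0, a)) :=
    eq_of_eval_natCast_eq fun N => by
      rw [freeSystem_eval_ncSum φ hφ, SpreadabilitySystem.eval_listPolynomial]
  have hl : labels (L.map fun a => (0, a)) = {0} := by
    ext i
    obtain ⟨a, ha⟩ := List.exists_mem_of_ne_nil L hL
    simp only [mem_labels, List.map_map, List.mem_map, Function.comp_apply, Finset.mem_singleton]
    exact ⟨fun ⟨_, _, h⟩ => h.symm, fun h => ⟨a, ha, h.symm⟩⟩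
  have hc : ¬ HasCrossing ((L.map fun a => (0, a)).map Prod.fst) := by
    rintro ⟨a, b, hab, h⟩
    have h0 : ∀ i ∈ [a, b, a, b], i = 0 := fun i hi => by
      have := h.subset hi
      rw [← List.mem_toFinset] at this
      change i ∈ labels _ at this
      rwa [hl, Finset.mem_singleton] at this
    exact hab ((h0 a (by simp)).trans (h0 b (by simp)).symm)
  have := (coeff_ncSum (freeCumulant φ) (L.map fun a => (0, a))).1 hc
  rw [hl, Finset.card_singleton, Finset.prod_singleton] at this
  rw [h, this, sub, List.filter_map, List.map_map, List.filter_eq_self.2 (by simp)]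
  congr 1
  exact List.map_id L

theorem freeSystem_cumulant {n : ℕ} (π : OrderedSetPartition n) (X : Fin n → A) :
    (π.IsNoncrossing → (freeSystem φ hφ).cumulant π X = (freeSystem φ hφ).mulCumulant π X) ∧
    (¬ π.IsNoncrossing → (freeSystem φ hφ).cumulant π X = 0) := by
  have hl : labels (π.word X) = Finset.range π.size := by
    ext a
    rw [mem_labels, π.mem_word X, Finset.mem_range]
  have h := coeff_ncSum (freeCumulant φ) (π.word X)
  rw [hl, Finset.card_range] at h
  rw [isNoncrossing_iff π X, not_not, (freeSystem φ hφ).cumulant_eq_coeff π X _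
    fun N => freeSystem_eval_ncSum φ hφ N (π.word X), SpreadabilitySystem.mulCumulant_eq]
  refine ⟨fun hc => (h.1 hc).trans (Finset.prod_congr rfl fun a ha => ?_), h.2⟩
  exact (freeSystem_listPolynomial_coeff φ hφ
    (sub_ne_nil.2 ((π.mem_word X a).2 (Finset.mem_range.1 ha)))).symm

end Systems

/-! ### The four cases together -/

theorem mainTheorem6 {A : Type u} {B : Type v} [Ring A] [Algebra ℂ A] [CommRing B] [Algebra ℂ B]
    (φ : A →ₗ[ℂ] B) (hφ : φ 1 = 1) (n : ℕ) (π : OrderedSetPartition n) :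
    (∀ X : Fin n → A, (tensorSystem φ hφ).cumulant π X = (tensorSystem φ hφ).mulCumulant π X) ∧
    ((π.IsNoncrossing →
        ∀ X : Fin n → A, (freeSystem φ hφ).cumulant π X = (freeSystem φ hφ).mulCumulant π X) ∧
      (¬ π.IsNoncrossing → ∀ X : Fin n → A, (freeSystem φ hφ).cumulant π X = 0)) ∧
    ((π.IsInterval →
        ∀ X : Fin n → A, (booleanSystem φ).cumulant π X = (booleanSystem φ).mulCumulant π X) ∧
      (¬ π.IsInterval → ∀ X : Fin n → A, (booleanSystem φ).cumulant π X = 0)) ∧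
    ((π.IsMonotone →
        ∀ X : Fin n → A, (monotoneSystem φ).cumulant π X = (monotoneSystem φ).mulCumulant π X) ∧
      (¬ π.IsMonotone → ∀ X : Fin n → A, (monotoneSystem φ).cumulant π X = 0)) := by
  exact ⟨fun X => tensorSystem_cumulant φ π X hφ,
    ⟨fun h X => (freeSystem_cumulant φ hφ π X).1 h, fun h X => (freeSystem_cumulant φ hφ π X).2 h⟩,
    ⟨fun h X => (booleanSystem_cumulant φ π X).1 h, fun h X => (booleanSystem_cumulant φ π X).2 h⟩,
    ⟨fun h X => (monotoneSystem_cumulant φ π X).1 h,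
      fun h X => (monotoneSystem_cumulant φ π X).2 h⟩⟩
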